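/- Let $M$ be a smooth real manifold of dimension $2n+k$ (with $n,k\ge 0$). View a bivector field $P$ on $M$ as a map from covectors to vectors, with bracket $\{f,g\}_P=\langle df,P\,dg\rangle$, and let $u\wedge v$ act on covectors by $\alpha\mapsto\alpha(v)u-\alpha(u)v$. Suppose that $M$ is an affine bihamiltonian manifold of corank $k$, meaning the following. (i) $P_0$, $P_1$ and $P_1-tP_0$, for all $t\in\mathbb R$, are Poisson tensors on $M$, and $P_0$ has corank $k$ at every point. (ii) $\mathcal Z\subset TM$ is an integrable distribution of rank $k$ transversal to the symplectic leaves of $P_0$, that is, $T_xM=\operatorname{Im}P_0(x)\oplus\mathcal Z_x$ for every $x$. For every $t$, the smooth functions on open subsets of $M$ that are invariant under $\mathcal Z$ are closed under the bracket of $P_1-tP_0$. (iii) For $a=1,\dots,k$ there is a polynomial Casimir $H^a(\lambda)=\lambda^{n_a}H^a_0+\lambda^{n_a-1}H^a_1+\dots+H^a_{n_a}$ of the pencil. That is, $n_a\ge 0$, the $H^a_j$ are smooth functions on $M$, and $(P_1-\lambda P_0)\,dH^a(\lambda)=0$ for all $\lambda\in\mathbb R$. The leading coefficients $H^1_0,\dots,H^k_0$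 form a complete set of Casimirs of $P_0$: their differentials are a basis of $\ker P_0$ at every point. (iv) $Z_1,\dots,Z_k$ are smooth vector fields that span $\mathcal Z$. They are normalized, $Z_b(H^a_0)=\delta^a_b$, and flat, $Z_b(Z_c(H^a(\lambda)))=0$ for all $a,b,c$ and all $\lambda$. Put $X_a=P_1\,dH^a_0$ and $\widetilde P_1=P_1-\sum_{a=1}^k X_a\wedge Z_a$. Let $D(\lambda)$ be the $k\times k$ matrix of polynomials in $\lambda$, with coefficients functions on $M$, whose entry in row $a$ and column $b$ is $D^a_b(\lambda)=Z_b(H^a(\lambda))$. Let $\Delta(\lambda)=\det D(\lambda)$, and let $\operatorname{adj}D(\lambda)$ be the classical adjoint of $D(\lambda)$. Then the following hold. 1. $\Delta(\lambda)$ is monic in $\lambda$ of degree $\nu=\sum_a n_a$. Write $\Delta(\lambda)=\lambda^\nu-\Delta_1\lambda^{\nu-1}+\cdots$, with $\Delta_1=0$ if $\nu=0$. For every $\lambda\in\mathbb R$, $$\widetilde P_1\,d\Delta(\lambda)=\lambda\,P_0\,d\Delta(\lambda)+\Delta(\lambda)\,P_0\,d\Delta_1 .$$ 2. Let $U\subset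 M$ be open and let $\lambda_i:U\to\mathbb C$ be a continuously differentiable function with $\Delta(\lambda_i)=0$ on $U$, that is, $\lambda_i(x)$ is a root of the polynomial $\Delta$ at $x$ for every $x\in U$. Then on $U$ $$\widetilde P_1\,d\lambda_i=\lambda_i\,P_0\,d\lambda_i .$$ 3. With $\lambda_i$ as in 2, for all $a,b,c\in\{1,\dots,k\}$ the ratio $$\rho(\lambda_i)=\frac{[\operatorname{adj}D(\lambda)]_{a,b}}{[\operatorname{adj}D(\lambda)]_{a,c}}\bigg|_{\lambda=\lambda_i}$$ satisfies $$\widetilde P_1\,d\rho(\lambda_i)=\lambda_i\,P_0\,d\rho(\lambda_i)$$ at every point of $U$ where $[\operatorname{adj}D(\lambda_i)]_{a,c}\neq 0$. For complex-valued functions the tensors act complex-linearly: $P\,d(u+iv)=P\,du+i\,P\,dv$ in the complexified tangent space. -/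

import Mathlib

open scoped Manifold ContDiff TensorProduct Polynomial

noncomputable section

namespace BiHam

section Tensors

variable {m : ℕ} {M : Type*} [TopologicalSpace M] [ChartedSpace (EuclideanSpace ℝ (Fin m)) M]

/-- The tangent space of the `m`-dimensional manifold `M` at `x`. -/
abbrev Tan (m : ℕ) {M : Type*} [TopologicalSpace M]
    [ChartedSpace (EuclideanSpace ℝ (Fin m)) M] (x : M) : Type :=
  TangentSpace (𝓡 m) x

/-- The real function `f` is smooth on the set `U`. -/
def SmoothOn (m : ℕ) {M : Type*} [TopologicalSpace M]
    [ChartedSpace (EuclideanSpace ℝ (Fin m)) M] (f : M → ℝ) (U : Set M) : Prop :=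
  ContMDiffOn (𝓡 m) 𝓘(ℝ, ℝ) ∞ f U

/-- The differential at `x` of a real function, a covector. -/
def diff (m : ℕ) {M : Type*} [TopologicalSpace M]
    [ChartedSpace (EuclideanSpace ℝ (Fin m)) M] (f : M → ℝ) (x : M) :
    Module.Dual ℝ (Tan m x) :=
  (mvfderiv (𝓡 m) f x).toLinearMap

/-- The derivative of the function `f` along the vector field `Z`. -/
def lie (Z : ∀ x : M, Tan m x) (f : M → ℝ) : M → ℝ :=
  fun x => diff m f x (Z x)

/-- Contravariant 2-tensor fields, viewed as maps from covectors to vectors. -/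
abbrev TensorField (m : ℕ) (M : Type*) [TopologicalSpace M]
    [ChartedSpace (EuclideanSpace ℝ (Fin m)) M] :=
  ∀ x : M, Module.Dual ℝ (Tan m x) →ₗ[ℝ] Tan m x

/-- The vector field `P df`. -/
def ham (P : TensorField m M) (f : M → ℝ) : ∀ x : M, Tan m x :=
  fun x => P x (diff m f x)

/-- The bracket `{f, g} = ⟨df, P dg⟩`. -/
def bracket (P : TensorField m M) (f g : M → ℝ) : M → ℝ :=
  fun x => diff m f x (ham P g x)

/-- A Poisson tensor: a smooth skew-symmetric tensor field whose bracket on (local) smooth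
functions satisfies the Jacobi identity. -/
structure IsPoisson (P : TensorField m M) : Prop where
  skew : ∀ (x : M) (α β : Module.Dual ℝ (Tan m x)), α (P x β) = -β (P x α)
  smooth : ∀ (U : Set M) (f g : M → ℝ), IsOpen U → SmoothOn m f U → SmoothOn m g U →
    SmoothOn m (bracket P f g) U
  jacobi : ∀ (U : Set M) (f g h : M → ℝ), IsOpen U →
    SmoothOn m f U → SmoothOn m g U → SmoothOn m h U → ∀ x ∈ U,
    bracket P f (bracket P g h) x + bracket P g (bracket P h f) x
      + bracket P h (bracket P f g) x = 0

/-- The pencil `P₁ - t P₀`. -/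
def pencil (P₁ P₀ : TensorField m M) (t : ℝ) : TensorField m M :=
  fun x => P₁ x - t • P₀ x

/-- A bihamiltonian structure: two Poisson tensors all of whose combinations `P₁ - t P₀`
are Poisson tensors. -/
structure IsBihamiltonian (P₁ P₀ : TensorField m M) : Prop where
  poisson_one : IsPoisson P₁
  poisson_zero : IsPoisson P₀
  compatible : ∀ t : ℝ, IsPoisson (pencil P₁ P₀ t)

/-- The bivector `u ∧ v = u ⊗ v - v ⊗ u` as the map `α ↦ α(v) u - α(u) v`. -/
def wedge {V : Type*} [AddCommGroup V] [Module ℝ V] (u v : V) : Module.Dual ℝ V →ₗ[ℝ] V :=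
  (Module.Dual.eval ℝ V v).smulRight u - (Module.Dual.eval ℝ V u).smulRight v

/-- The deformed tensor `P₁ - ∑ₐ Xₐ ∧ Zₐ`, where `Xₐ = P₁ dCₐ`. -/
def deformed {k : ℕ} (P₁ : TensorField m M) (C : Fin k → M → ℝ)
    (Z : Fin k → ∀ x : M, Tan m x) : TensorField m M :=
  fun x => P₁ x - ∑ a, wedge (ham P₁ (C a) x) (Z a x)

/-- `P df` for a complex function `f = u + i v`, i.e. the vector `P du + i P dv` of the
complexified tangent space. -/
def hamC (P : TensorField m M) (f : M → ℂ) (x : M) : ℂ ⊗[ℝ] Tan m x :=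
  (1 : ℂ) ⊗ₜ[ℝ] ham P (fun y => (f y).re) x + Complex.I ⊗ₜ[ℝ] ham P (fun y => (f y).im) x

/-- `f` is invariant on `U` under the distribution `𝒵`. -/
def InvariantOn (𝒵 : ∀ x : M, Submodule ℝ (Tan m x)) (f : M → ℝ) (U : Set M) : Prop :=
  ∀ x ∈ U, ∀ v ∈ 𝒵 x, diff m f x v = 0

end Tensors

section Affine

variable {n k : ℕ} {M : Type*} [TopologicalSpace M]
  [ChartedSpace (EuclideanSpace ℝ (Fin (2 * n + k))) M]

/-- A rank `k` distribution on a manifold of dimension `2n+k` is integrable: near every point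
its leaves are the common level sets of `2n` functions with independent differentials. -/
def IsIntegrable (n k : ℕ) {M : Type*} [TopologicalSpace M]
    [ChartedSpace (EuclideanSpace ℝ (Fin (2 * n + k))) M]
    (𝒵 : ∀ x : M, Submodule ℝ (Tan (2 * n + k) x)) : Prop :=
  ∀ x : M, ∃ (U : Set M) (f : Fin (2 * n) → M → ℝ), IsOpen U ∧ x ∈ U ∧
    (∀ i, SmoothOn (2 * n + k) (f i) U) ∧
    ∀ y ∈ U, LinearIndependent ℝ (fun i => diff (2 * n + k) (f i) y) ∧
      𝒵 y = ⨅ i, LinearMap.ker (diff (2 * n + k) (f i) y)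

/-- A corank `k` bihamiltonian manifold of dimension `2n+k` with a transversal distribution:
`𝒵` is a `k`-dimensional integrable distribution, transversal to the symplectic leaves of `P₀`
(whose tangent spaces are the ranges of `P₀`), and the (local) functions invariant under `𝒵` are
closed under all brackets of the pencil. -/
structure IsTransversal (P₁ P₀ : TensorField (2 * n + k) M)
    (𝒵 : ∀ x : M, Submodule ℝ (Tan (2 * n + k) x)) : Prop where
  bihamiltonian : IsBihamiltonian P₁ P₀
  corank : ∀ x : M, Module.finrank ℝ (LinearMap.range (P₀ x)) = 2 * n
  finrank : ∀ x : M, Module.finrank ℝ (𝒵 x) = k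
  integrable : IsIntegrable n k 𝒵
  transversal : ∀ x : M, IsCompl (LinearMap.range (P₀ x)) (𝒵 x)
  subalgebra : ∀ (t : ℝ) (U : Set M) (f g : M → ℝ), IsOpen U →
    SmoothOn (2 * n + k) f U → SmoothOn (2 * n + k) g U →
    InvariantOn 𝒵 f U → InvariantOn 𝒵 g U → InvariantOn 𝒵 (bracket (pencil P₁ P₀ t) f g) U

/-- `C₁, …, C_k` is a complete set of Casimirs of `P₀`. -/
structure IsCompleteCasimirs (P₀ : TensorField (2 * n + k) M) (C : Fin k → M → ℝ) : Prop where
  smooth : ∀ a, SmoothOn (2 * n + k) (C a) Set.univ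
  independent : ∀ x : M, LinearIndependent ℝ (fun a => diff (2 * n + k) (C a) x)
  span : ∀ x : M, Submodule.span ℝ (Set.range fun a => diff (2 * n + k) (C a) x)
    = LinearMap.ker (P₀ x)

/-- The value at `t` of the family of polynomials `t^N h₀ + t^(N-1) h₁ + ⋯ + h_N`, as a function
on `M`. -/
def polyFun {M : Type*} (N : ℕ) (h : ℕ → M → ℝ) (t : ℝ) : M → ℝ :=
  fun x => ∑ j ∈ Finset.range (N + 1), t ^ (N - j) * h j x

/-- An affine structure: the polynomials `Hᵃ(t) = t^(Nₐ) Hᵃ₀ + ⋯ + Hᵃ_(Nₐ)` are Casimirs of the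
pencil, their leading coefficients form a complete set of Casimirs of `P₀`, and `Z₁, …, Z_k` are
generators of the transversal distribution `𝒵` that are normalized (`Z_b(Hᵃ₀) = δᵃ_b`) and flat
(`Z_b(Z_c(Hᵃ(t))) = 0`). Only the `H a j` with `j ≤ N a` matter. -/
structure IsAffine [IsManifold (𝓡 (2 * n + k)) ∞ M] (P₁ P₀ : TensorField (2 * n + k) M)
    (𝒵 : ∀ x : M, Submodule ℝ (Tan (2 * n + k) x))
    (N : Fin k → ℕ) (H : Fin k → ℕ → M → ℝ)
    (Z : Fin k → ∀ x : M, Tan (2 * n + k) x) : Prop where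
  transversal : IsTransversal P₁ P₀ 𝒵
  smooth : ∀ a, ∀ j ≤ N a, SmoothOn (2 * n + k) (H a j) Set.univ
  casimir : ∀ a (t : ℝ) (x : M), ham (pencil P₁ P₀ t) (polyFun (N a) (H a) t) x = 0
  complete : IsCompleteCasimirs P₀ (fun a => H a 0)
  smooth_generators : ∀ a, ContMDiff (𝓡 (2 * n + k)) (𝓡 (2 * n + k)).tangent ∞
    (fun x => (⟨x, Z a x⟩ : TangentBundle (𝓡 (2 * n + k)) M))
  generators : ∀ x : M, Submodule.span ℝ (Set.range fun a => Z a x) = 𝒵 x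
  normalized : ∀ a b (x : M), lie (Z b) (H a 0) x = if a = b then 1 else 0
  flat : ∀ a b c (t : ℝ) (x : M), lie (Z b) (lie (Z c) (polyFun (N a) (H a) t)) x = 0

/-- The matrix `Dᵃ_b = Z_b(Hᵃ)` of polynomials, at the point `x`: row `a`, column `b`. -/
def defMatrix {m : ℕ} {M : Type*} [TopologicalSpace M]
    [ChartedSpace (EuclideanSpace ℝ (Fin m)) M] {k : ℕ} (N : Fin k → ℕ)
    (H : Fin k → ℕ → M → ℝ) (Z : Fin k → ∀ x : M, Tan m x) (x : M) :
    Matrix (Fin k) (Fin k) ℝ[X] :=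
  Matrix.of fun a b => ∑ j ∈ Finset.range (N a + 1),
    Polynomial.C (lie (Z b) (H a j) x) * Polynomial.X ^ (N a - j)

end Affine

end BiHam

end

/-! Fix $\lambda$ and put $h=H^a(\lambda)$, $g=Z_b(h)$, $P_\lambda=P_1-\lambda P_0$. The core
identity (`IsAffine.exists_ham_deformed_lie`) is $(\widetilde P_1-\lambda P_0)\,dg=-\sum_c
Z_c(h)\,[Z_b,X_c]$. Flatness reduces the left side to $P_\lambda\,dg+\sum_c dg(X_c)\,Z_c$. The
difference of the two sides lies in $\mathcal Z$: for a local invariant $f$, the commutator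
$[Z_b,P_\lambda\,df]$ is tangent to $\mathcal Z$ because brackets of invariants are invariant, and
expanding it in the $Z_c$ and applying it to the Casimir $h$ gives the identity tested on $f$. The
difference is also annihilated by every $dH^e_0$, by normalization and involution of the $H^e_0$,
and so it is zero.

Pair with a covector $\alpha$ and let $\delta$ be the resulting derivation on families of
polynomials, acting on coefficients. The identity becomes $\delta D=-D\,\theta$ with a real matrix
$\theta$ that does not depend on $\lambda$. Jacobi's formula gives
$\delta\Delta=-\operatorname{tr}(\theta)\,\Delta$, and the coefficient of $\lambda^\nu$ identifies
$-\operatorname{tr}\theta$ with $\alpha(P_0\,d\Delta_1)$ (`IsAffine.exists_pencilDeriv_det`). This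
is claim 1. Differentiating $\operatorname{adj}D\cdot D=\Delta\cdot 1$ gives
$\delta\operatorname{adj}D=(\theta-\operatorname{tr}\theta)\operatorname{adj}D$.

For a simple root, claim 2 is claim 1 with the chain rule. Multiplicity may vary from point to
point, so the general case is by contradiction (`IsAffine.lieC_root`): where the eigenvalue equation
fails it fails on an open set; there, take the least order at which some $\lambda$-derivative of
$\Delta$ along the root is not identically zero, and a point where it is nonzero. All lower
derivatives vanish nearby, and differentiating $\delta\Delta=-\operatorname{tr}(\theta)\,\Delta$ in
$\lambda$ gives the equation at that point.

For claim 3 (`IsAffine.lieC_ratio`), $D(\lambda_i)$ is singular, so the $2\times2$ minors of its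
adjugate vanish. The terms in $\theta$ then cancel in the derivative of a ratio of two entries of
one row. -/

noncomputable section

namespace BiHam

/-! ### Differentials and partial derivatives in charts. -/

section Calculus

variable {m : ℕ} {M : Type*} [TopologicalSpace M] [ChartedSpace (EuclideanSpace ℝ (Fin m)) M]

/-- The real function `f` is differentiable at `x`. -/
abbrev DiffAt (m : ℕ) {M : Type*} [TopologicalSpace M]
    [ChartedSpace (EuclideanSpace ℝ (Fin m)) M] (f : M → ℝ) (x : M) : Prop :=
  MDifferentiableAt (𝓡 m) 𝓘(ℝ, ℝ) f x

lemma SmoothOn.contMDiffAt {f : M → ℝ} {U : Set M} (hf : SmoothOn m f U) (hU : IsOpen U) {x : M}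
    (hx : x ∈ U) : ContMDiffAt (𝓡 m) 𝓘(ℝ, ℝ) ∞ f x :=
  ContMDiffOn.contMDiffAt hf (hU.mem_nhds hx)

lemma SmoothOn.diffAt {f : M → ℝ} {U : Set M} (hf : SmoothOn m f U) (hU : IsOpen U) {x : M}
    (hx : x ∈ U) : DiffAt m f x :=
  (hf.contMDiffAt hU hx).mdifferentiableAt (by simp)

lemma SmoothOn.mono {f : M → ℝ} {U V : Set M} (hf : SmoothOn m f U) (h : V ⊆ U) :
    SmoothOn m f V := ContMDiffOn.mono hf h

lemma diff_congr {f g : M → ℝ} {x : M} (h : f =ᶠ[nhds x] g) : diff m f x = diff m g x := by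
  have e := h.mfderiv_eq (I := 𝓡 m) (I' := 𝓘(ℝ, ℝ))
  exact LinearMap.ext fun v => congrArg (fun L : Tan m x →L[ℝ] ℝ => L v) e

lemma diff_congr_on {f g : M → ℝ} {U : Set M} (hU : IsOpen U) {x : M} (hx : x ∈ U)
    (h : ∀ y ∈ U, f y = g y) : diff m f x = diff m g x :=
  diff_congr (Filter.eventuallyEq_of_mem (hU.mem_nhds hx) h)

lemma diff_const (c : ℝ) (x : M) : diff m (fun _ : M => c) x = 0 := by
  unfold diff
  rw [mvfderiv_const]; rfl

lemma diff_add {f g : M → ℝ} {x : M} (hf : DiffAt m f x) (hg : DiffAt m g x) :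
    diff m (fun y => f y + g y) x = diff m f x + diff m g x := by
  unfold diff
  rw [mvfderiv_fun_add hf hg]; rfl

lemma diff_sub {f g : M → ℝ} {x : M} (hf : DiffAt m f x) (hg : DiffAt m g x) :
    diff m (fun y => f y - g y) x = diff m f x - diff m g x := by
  unfold diff
  rw [mvfderiv_fun_sub hf hg]; rfl

lemma diff_neg {f : M → ℝ} {x : M} :
    diff m (fun y => - f y) x = - diff m f x := by
  unfold diff
  rw [mvfderiv_fun_neg]; rfl

lemma diffAt_const (c : ℝ) (x : M) : DiffAt m (fun _ : M => c) x := mdifferentiableAt_const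

lemma DiffAt.mul {f g : M → ℝ} {x : M} (hf : DiffAt m f x) (hg : DiffAt m g x) :
    DiffAt m (fun y => f y * g y) x := MDifferentiableAt.mul hf hg

lemma diff_mul {f g : M → ℝ} {x : M} (hf : DiffAt m f x) (hg : DiffAt m g x) :
    diff m (fun y => f y * g y) x = f x • diff m g x + g x • diff m f x := by
  unfold diff
  rw [mvfderiv_fun_mul hf hg]; rfl

lemma diff_const_mul {f : M → ℝ} {x : M} (c : ℝ) (hf : DiffAt m f x) :
    diff m (fun y => c * f y) x = c • diff m f x := by
  rw [diff_mul (diffAt_const c x) hf, diff_const, smul_zero, add_zero]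

lemma DiffAt.sum {ι : Type*} (s : Finset ι) {f : ι → M → ℝ} {x : M}
    (hf : ∀ i ∈ s, DiffAt m (f i) x) : DiffAt m (fun y => ∑ i ∈ s, f i y) x := by
  classical
  induction s using Finset.induction_on with
  | empty => simpa using (mdifferentiableAt_const : DiffAt m (fun _ : M => (0 : ℝ)) x)
  | insert a s ha ih =>
    simp only [Finset.sum_insert ha]
    exact (hf a (by simp)).add (ih fun i hi => hf i (by simp [hi]))

lemma diff_sum {ι : Type*} (s : Finset ι) {f : ι → M → ℝ} {x : M}
    (hf : ∀ i ∈ s, DiffAt m (f i) x) :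
    diff m (fun y => ∑ i ∈ s, f i y) x = ∑ i ∈ s, diff m (f i) x := by
  classical
  induction s using Finset.induction_on with
  | empty => simpa using diff_const 0 x
  | insert a s ha ih =>
    simp only [Finset.sum_insert ha]
    rw [diff_add (hf a (by simp)) (DiffAt.sum s fun i hi => hf i (by simp [hi])),
      ih fun i hi => hf i (by simp [hi])]

/-- The `i`-th coordinate function of the chart at `x₀`. -/
def coord (x₀ : M) (i : Fin m) : M → ℝ := fun y => extChartAt (𝓡 m) x₀ y i

/-- The partial derivative with respect to the `i`-th coordinate of the chart at `x₀`. -/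
def pd (x₀ : M) (i : Fin m) (g : M → ℝ) : M → ℝ := fun y =>
  fderiv ℝ (g ∘ (extChartAt (𝓡 m) x₀).symm) (extChartAt (𝓡 m) x₀ y) (EuclideanSpace.single i 1)

variable [IsManifold (𝓡 m) ∞ M]

lemma contDiffAt_comp_symm {x₀ y : M} {k : ℕ∞ω} (hk : k ≤ ∞) {g : M → ℝ}
    (hy : y ∈ (chartAt (EuclideanSpace ℝ (Fin m)) x₀).source)
    (hg : ContMDiffAt (𝓡 m) 𝓘(ℝ, ℝ) k g y) :
    ContDiffAt ℝ k (g ∘ (extChartAt (𝓡 m) x₀).symm) (extChartAt (𝓡 m) x₀ y) := by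
  have hy' : y ∈ (extChartAt (𝓡 m) x₀).source := by rwa [extChartAt_source]
  rw [← contMDiffAt_iff_contDiffAt]
  have h1 : ContMDiffAt 𝓘(ℝ, EuclideanSpace ℝ (Fin m)) (𝓡 m) k (extChartAt (𝓡 m) x₀).symm
      (extChartAt (𝓡 m) x₀ y) := by
    have := (contMDiffOn_extChartAt_symm (I := 𝓡 m) (n := ∞) x₀).contMDiffAt
      ((isOpen_extChartAt_target x₀).mem_nhds ((extChartAt (𝓡 m) x₀).map_source hy'))
    exact this.of_le hk
  refine ContMDiffAt.comp _ ?_ h1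
  rwa [(extChartAt (𝓡 m) x₀).left_inv hy']

lemma differentiableAt_comp_symm {x₀ y : M} {g : M → ℝ}
    (hy : y ∈ (chartAt (EuclideanSpace ℝ (Fin m)) x₀).source)
    (hg : DiffAt m g y) :
    DifferentiableAt ℝ (g ∘ (extChartAt (𝓡 m) x₀).symm) (extChartAt (𝓡 m) x₀ y) := by
  have hy' : y ∈ (extChartAt (𝓡 m) x₀).source := by rwa [extChartAt_source]
  rw [← mdifferentiableAt_iff_differentiableAt]
  have h1 : MDifferentiableAt 𝓘(ℝ, EuclideanSpace ℝ (Fin m)) (𝓡 m) (extChartAt (𝓡 m) x₀).symm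
      (extChartAt (𝓡 m) x₀ y) := by
    have := (contMDiffOn_extChartAt_symm (I := 𝓡 m) (n := ∞) x₀).contMDiffAt
      ((isOpen_extChartAt_target x₀).mem_nhds ((extChartAt (𝓡 m) x₀).map_source hy'))
    exact this.mdifferentiableAt (by simp)
  refine MDifferentiableAt.comp _ ?_ h1
  rwa [(extChartAt (𝓡 m) x₀).left_inv hy']

/-- The differential of the chart at `x₀`. -/
def dchart (x₀ y : M) : Tan m y →L[ℝ] EuclideanSpace ℝ (Fin m) :=
  mfderiv (𝓡 m) 𝓘(ℝ, EuclideanSpace ℝ (Fin m)) (extChartAt (𝓡 m) x₀) y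

lemma diff_comp_chart {x₀ y : M} {F : EuclideanSpace ℝ (Fin m) → ℝ}
    (hy : y ∈ (chartAt (EuclideanSpace ℝ (Fin m)) x₀).source)
    (hF : DifferentiableAt ℝ F (extChartAt (𝓡 m) x₀ y)) (v : Tan m y) :
    diff m (fun z => F (extChartAt (𝓡 m) x₀ z)) y v
      = fderiv ℝ F (extChartAt (𝓡 m) x₀ y) (dchart x₀ y v) := by
  have h := mvfderiv_comp_apply y hF.mdifferentiableAt (mdifferentiableAt_extChartAt (I := 𝓡 m) hy) v
  refine Eq.trans h ?_
  unfold mvfderiv dchart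
  rw [mfderiv_eq_fderiv]
  rfl

lemma diff_eq_fderiv {x₀ y : M} {g : M → ℝ}
    (hy : y ∈ (chartAt (EuclideanSpace ℝ (Fin m)) x₀).source) (hg : DiffAt m g y) (v : Tan m y) :
    diff m g y v = fderiv ℝ (g ∘ (extChartAt (𝓡 m) x₀).symm) (extChartAt (𝓡 m) x₀ y)
      (dchart x₀ y v) := by
  rw [← diff_comp_chart hy (differentiableAt_comp_symm hy hg)]
  congr 1
  refine diff_congr_on (chartAt (EuclideanSpace ℝ (Fin m)) x₀).open_source hy fun z hz => ?_
  have hz' : z ∈ (extChartAt (𝓡 m) x₀).source := by rwa [extChartAt_source]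
  simp only [Function.comp, (extChartAt (𝓡 m) x₀).left_inv hz']

lemma diff_coord {x₀ y : M} (hy : y ∈ (chartAt (EuclideanSpace ℝ (Fin m)) x₀).source)
    (i : Fin m) (v : Tan m y) : diff m (coord x₀ i) y v = dchart x₀ y v i := by
  have h := diff_comp_chart (F := EuclideanSpace.proj (𝕜 := ℝ) i) hy
    (EuclideanSpace.proj (𝕜 := ℝ) i).differentiableAt v
  rw [ContinuousLinearMap.fderiv] at h
  exact h

lemma smoothOn_coord (x₀ : M) (i : Fin m) :
    SmoothOn m (coord x₀ i) (chartAt (EuclideanSpace ℝ (Fin m)) x₀).source := by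
  have h := contMDiffOn_extChartAt (I := 𝓡 m) (n := ∞) (x := x₀)
  exact ((EuclideanSpace.proj (𝕜 := ℝ) i).contDiff.contMDiff).comp_contMDiffOn h

lemma dchart_bijective {x₀ y : M} (hy : y ∈ (chartAt (EuclideanSpace ℝ (Fin m)) x₀).source) :
    Function.Bijective (dchart (m := m) x₀ y) := by
  have hy' : y ∈ (extChartAt (𝓡 m) x₀).source := by rwa [extChartAt_source]
  exact (isInvertible_mfderiv_extChartAt hy').bijective

/-- The differential of a function in coordinates. -/
lemma diff_eq_sum {x₀ y : M} {g : M → ℝ}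
    (hy : y ∈ (chartAt (EuclideanSpace ℝ (Fin m)) x₀).source) (hg : DiffAt m g y) (v : Tan m y) :
    diff m g y v = ∑ i : Fin m, pd x₀ i g y * diff m (coord x₀ i) y v := by
  rw [diff_eq_fderiv hy hg]
  simp only [diff_coord hy]
  have hv : dchart x₀ y v = ∑ i, dchart x₀ y v i • EuclideanSpace.single i (1 : ℝ) := by
    ext j; simp [Pi.single_apply]
  conv_lhs => rw [hv]
  rw [map_sum]
  refine Finset.sum_congr rfl fun i _ => ?_
  rw [map_smul, smul_eq_mul, mul_comm]; rfl

lemma contMDiffAt_pd {x₀ y : M} {g : M → ℝ} {j k : ℕ∞ω} (hjk : j + 1 ≤ k) (hk : k ≤ ∞)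
    (hy : y ∈ (chartAt (EuclideanSpace ℝ (Fin m)) x₀).source)
    (hg : ContMDiffAt (𝓡 m) 𝓘(ℝ, ℝ) k g y) (i : Fin m) :
    ContMDiffAt (𝓡 m) 𝓘(ℝ, ℝ) j (pd x₀ i g) y := by
  have h1 := (contDiffAt_comp_symm hk hy hg).fderiv_right hjk
  have h2 : ContDiffAt ℝ j (fun z => fderiv ℝ (g ∘ (extChartAt (𝓡 m) x₀).symm) z
    (EuclideanSpace.single i 1)) (extChartAt (𝓡 m) x₀ y) := h1.clm_apply contDiffAt_const
  have h3 : ContMDiffAt (𝓡 m) 𝓘(ℝ, EuclideanSpace ℝ (Fin m)) j (extChartAt (𝓡 m) x₀) y :=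
    (contMDiffAt_extChartAt' (n := ∞) hy).of_le (le_trans (le_trans le_self_add hjk) hk)
  exact h2.contMDiffAt.comp y h3

lemma pd_comm {x₀ y : M} {g : M → ℝ}
    (hy : y ∈ (chartAt (EuclideanSpace ℝ (Fin m)) x₀).source)
    (hg : ContMDiffAt (𝓡 m) 𝓘(ℝ, ℝ) ∞ g y) (i j : Fin m) :
    pd x₀ i (pd x₀ j g) y = pd x₀ j (pd x₀ i g) y := by
  have hy' : y ∈ (extChartAt (𝓡 m) x₀).source := by rwa [extChartAt_source]
  have h0 := contDiffAt_comp_symm le_rfl hy hg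
  have h1 : DifferentiableAt ℝ (fderiv ℝ (g ∘ (extChartAt (𝓡 m) x₀).symm))
      (extChartAt (𝓡 m) x₀ y) :=
    (h0.fderiv_right (m := 1) (WithTop.coe_le_coe.2 (le_top : (1 + 1 : ℕ∞) ≤ ⊤))).differentiableAt (by simp)
  have key : ∀ i j : Fin m, pd x₀ i (pd x₀ j g) y =
      fderiv ℝ (fderiv ℝ (g ∘ (extChartAt (𝓡 m) x₀).symm)) (extChartAt (𝓡 m) x₀ y)
        (EuclideanSpace.single i 1) (EuclideanSpace.single j 1) := by
    intro i j
    have e : (pd x₀ j g ∘ (extChartAt (𝓡 m) x₀).symm) =ᶠ[nhds (extChartAt (𝓡 m) x₀ y)]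
        fun z => fderiv ℝ (g ∘ (extChartAt (𝓡 m) x₀).symm) z (EuclideanSpace.single j 1) := by
      filter_upwards [(isOpen_extChartAt_target x₀).mem_nhds
        ((extChartAt (𝓡 m) x₀).map_source hy')] with z hz
      simp only [Function.comp, pd, (extChartAt (𝓡 m) x₀).right_inv hz]
    rw [pd, e.fderiv_eq, fderiv_clm_apply h1 (differentiableAt_const _)]
    simp
  rw [key, key]
  refine (h0.isSymmSndFDerivAt ?_).eq _ _
  simpa using (WithTop.coe_le_coe.2 (le_top : (2 : ℕ∞) ≤ ⊤) : (2 : ℕ∞ω) ≤ ∞)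

end Calculus

/-! ### Smooth vector fields, commutators, and covectors as differentials. -/

section Fields

variable {m : ℕ} {M : Type*} [TopologicalSpace M] [ChartedSpace (EuclideanSpace ℝ (Fin m)) M]

/-- The vector field `V` differentiates smooth functions on open subsets of `U` to smooth
functions. -/
def IsSmoothField (V : ∀ x : M, Tan m x) (U : Set M) : Prop :=
  ∀ (U' : Set M) (g : M → ℝ), U' ⊆ U → IsOpen U' → SmoothOn m g U' → SmoothOn m (lie V g) U'

lemma IsSmoothField.mono {V : ∀ x : M, Tan m x} {U U' : Set M} (h : IsSmoothField V U)
    (hU : U' ⊆ U) : IsSmoothField V U' :=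
  fun W g hW => h W g (hW.trans hU)

lemma lie_ham_eq_neg {P : TensorField m M}
    (hP : ∀ (x : M) (α β : Module.Dual ℝ (Tan m x)), α (P x β) = -β (P x α)) (f g : M → ℝ) (x : M) :
    lie (ham P f) g x = - lie (ham P g) f x := hP x _ _

lemma IsPoisson.isSmoothField_ham {P : TensorField m M} (hP : IsPoisson P) {f : M → ℝ} {U : Set M}
    (hf : SmoothOn m f U) : IsSmoothField (ham P f) U :=
  fun U' g hU hU' hg => hP.smooth U' g f hU' hg (hf.mono hU)

lemma lie_congr_on {V : ∀ x : M, Tan m x} {f g : M → ℝ} {U : Set M} (hU : IsOpen U)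
    (h : ∀ y ∈ U, f y = g y) {x : M} (hx : x ∈ U) : lie V f x = lie V g x := by
  unfold lie
  rw [diff_congr_on hU hx h]

lemma deformed_apply {k : ℕ} (P₁ : TensorField m M) (C : Fin k → M → ℝ)
    (Z : Fin k → ∀ x : M, Tan m x) (x : M) (α : Module.Dual ℝ (Tan m x)) :
    deformed P₁ C Z x α
      = P₁ x α - ∑ c, (α (Z c x) • ham P₁ (C c) x - α (ham P₁ (C c) x) • Z c x) := by
  simp only [deformed, LinearMap.sub_apply, LinearMap.sum_apply, wedge, LinearMap.smulRight_apply,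
    Module.Dual.eval_apply]

variable [IsManifold (𝓡 m) ∞ M]

lemma isSmoothField_of_contMDiff {Z : ∀ x : M, Tan m x}
    (hZ : ContMDiff (𝓡 m) (𝓡 m).tangent ∞ (fun x => (⟨x, Z x⟩ : TangentBundle (𝓡 m) M)))
    (U : Set M) : IsSmoothField Z U := by
  intro U' g _ hU' hg
  have hM : IsManifold (𝓡 m) 1 M := IsManifold.of_le (n := ∞) (by simp)
  have h1 := ContMDiffOn.contMDiffOn_tangentMapWithin (m := ∞) (n := ∞) hg (by simp)
    hU'.uniqueMDiffOn
  have h2 : ContMDiffOn (𝓡 m) (𝓘(ℝ, ℝ)).tangent ∞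
      (fun y => tangentMapWithin (𝓡 m) 𝓘(ℝ, ℝ) g U' ⟨y, Z y⟩) U' := fun y hy =>
    (h1 ⟨y, Z y⟩ hy).comp y hZ.contMDiffAt.contMDiffWithinAt (fun z hz => hz)
  have h3 := (contMDiff_snd_tangentBundle_modelSpace ℝ 𝓘(ℝ, ℝ) (n := ∞)).comp_contMDiffOn h2
  refine h3.congr fun y hy => ?_
  have : mfderivWithin (𝓡 m) 𝓘(ℝ, ℝ) g U' y = mfderiv (𝓡 m) 𝓘(ℝ, ℝ) g y :=
    mfderivWithin_of_isOpen hU' hy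
  exact (congrArg (fun L : Tan m y →L[ℝ] ℝ => L (Z y)) this).symm

lemma lie_eq_sum (V : ∀ x : M, Tan m x) {x₀ y : M} {g : M → ℝ}
    (hy : y ∈ (chartAt (EuclideanSpace ℝ (Fin m)) x₀).source) (hg : DiffAt m g y) :
    lie V g y = ∑ i : Fin m, pd x₀ i g y * lie V (coord x₀ i) y :=
  diff_eq_sum hy hg _

/-- A smooth vector field differentiates `C¹` functions to continuous functions. -/
lemma IsSmoothField.continuousAt_lie {V : ∀ x : M, Tan m x} {U : Set M} (hV : IsSmoothField V U)
    (hU : IsOpen U) {g : M → ℝ} (hg : ContMDiffOn (𝓡 m) 𝓘(ℝ, ℝ) 1 g U) {x : M} (hx : x ∈ U) :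
    ContinuousAt (lie V g) x := by
  set S := (chartAt (EuclideanSpace ℝ (Fin m)) x).source
  have hS : IsOpen S := (chartAt (EuclideanSpace ℝ (Fin m)) x).open_source
  have hxS : x ∈ S := mem_chart_source _ x
  have e : lie V g =ᶠ[nhds x] fun y => ∑ i : Fin m, pd x i g y * lie V (coord x i) y := by
    filter_upwards [hS.mem_nhds hxS, hU.mem_nhds hx] with y hy hyU
    exact lie_eq_sum V hy ((hg.contMDiffAt (hU.mem_nhds hyU)).mdifferentiableAt (by simp))
  refine ContinuousAt.congr ?_ e.symm
  refine tendsto_finsetSum _ fun i _ => ContinuousAt.mul ?_ ?_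
  · exact (contMDiffAt_pd (j := 0) (k := 1) (by simp) (by simp) hxS
      (hg.contMDiffAt (hU.mem_nhds hx)) i).continuousAt
  · have := hV (U ∩ S) (coord x i) Set.inter_subset_left (hU.inter hS)
      ((smoothOn_coord x i).mono Set.inter_subset_right)
    exact (this.contMDiffAt (hU.inter hS) ⟨hx, hxS⟩).continuousAt

/-- The commutator of two smooth vector fields is a vector. -/
lemma exists_commutator {V W : ∀ x : M, Tan m x} {U : Set M} (hU : IsOpen U)
    (hV : IsSmoothField V U) (hW : IsSmoothField W U) {x : M} (hx : x ∈ U) :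
    ∃ w : Tan m x, ∀ (g : M → ℝ) (U' : Set M), IsOpen U' → x ∈ U' → SmoothOn m g U' →
      diff m g x w = lie V (lie W g) x - lie W (lie V g) x := by
  set S := (chartAt (EuclideanSpace ℝ (Fin m)) x).source
  have hS : IsOpen S := (chartAt (EuclideanSpace ℝ (Fin m)) x).open_source
  have hxS : x ∈ S := mem_chart_source _ x
  -- The vector is prescribed by its action on the coordinate functions.
  obtain ⟨w, hw⟩ := (dchart_bijective hxS).2 (WithLp.toLp 2 fun i =>
    lie V (lie W (coord x i)) x - lie W (lie V (coord x i)) x)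
  refine ⟨w, fun g U₀ hU₀ hx₀ hg => ?_⟩
  set U' := U₀ ∩ (U ∩ S)
  have hU' : IsOpen U' := hU₀.inter (hU.inter hS)
  have hxU' : x ∈ U' := ⟨hx₀, hx, hxS⟩
  have hgU : SmoothOn m g U' := hg.mono Set.inter_subset_left
  have hgd : ∀ y ∈ U', DiffAt m g y := fun y hy => hgU.diffAt hU' hy
  have hc : ∀ i : Fin m, SmoothOn m (coord x i) U' :=
    fun i => (smoothOn_coord x i).mono fun y hy => hy.2.2
  have hpd : ∀ i, SmoothOn m (pd x i g) U' := fun i y hy =>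
    (contMDiffAt_pd (j := ∞) (k := ∞) (by simp) le_rfl hy.2.2 (hgU.contMDiffAt hU' hy)
      i).contMDiffWithinAt
  have key : ∀ {A B : ∀ x : M, Tan m x}, IsSmoothField A U → IsSmoothField B U →
      lie A (lie B g) x = ∑ i : Fin m, pd x i g x * lie A (lie B (coord x i)) x
        + ∑ i : Fin m, ∑ j : Fin m,
          pd x j (pd x i g) x * lie A (coord x j) x * lie B (coord x i) x := by
    intro A B hA hB
    have hBc : ∀ i, DiffAt m (lie B (coord x i)) x := fun i =>
      (hB U' _ (fun y hy => hy.2.1) hU' (hc i)).diffAt hU' hxU'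
    rw [lie_congr_on hU' (fun y hy => lie_eq_sum B hy.2.2 (hgd y hy)) hxU']
    unfold lie at hBc ⊢
    rw [diff_sum _ fun i _ => DiffAt.mul ((hpd i).diffAt hU' hxU') (hBc i), LinearMap.sum_apply,
      ← Finset.sum_add_distrib]
    refine Finset.sum_congr rfl fun i _ => ?_
    rw [diff_mul ((hpd i).diffAt hU' hxU') (hBc i), LinearMap.add_apply, LinearMap.smul_apply,
      LinearMap.smul_apply, diff_eq_sum hxS ((hpd i).diffAt hU' hxU') (A x), smul_eq_mul,
      smul_eq_mul, Finset.mul_sum]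
    congr 1
    exact Finset.sum_congr rfl fun j _ => by ring
  rw [diff_eq_sum hxS (hgd x hxU'), key hV hW, key hW hV]
  -- The second-order terms agree because partial derivatives commute, so the commutator is of first
  -- order.
  have hsymm : ∑ i : Fin m, ∑ j : Fin m,
        pd x j (pd x i g) x * lie W (coord x j) x * lie V (coord x i) x
      = ∑ i : Fin m, ∑ j : Fin m,
        pd x j (pd x i g) x * lie V (coord x j) x * lie W (coord x i) x := by
    rw [Finset.sum_comm]
    refine Finset.sum_congr rfl fun i _ => Finset.sum_congr rfl fun j _ => ?_
    rw [pd_comm hxS (hgU.contMDiffAt hU' hxU') i j]; ring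
  rw [hsymm, add_sub_add_right_eq_sub, ← Finset.sum_sub_distrib]
  refine Finset.sum_congr rfl fun i _ => ?_
  rw [diff_coord hxS, hw, ← mul_sub]

/-- Every covector is the differential of a local smooth function. -/
lemma exists_diff_eq (x : M) (α : Module.Dual ℝ (Tan m x)) :
    ∃ g : M → ℝ, SmoothOn m g (chartAt (EuclideanSpace ℝ (Fin m)) x).source ∧ diff m g x = α := by
  have hS : IsOpen (chartAt (EuclideanSpace ℝ (Fin m)) x).source :=
    (chartAt (EuclideanSpace ℝ (Fin m)) x).open_source
  have hxS : x ∈ (chartAt (EuclideanSpace ℝ (Fin m)) x).source := mem_chart_source _ x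
  let e := LinearEquiv.ofBijective (dchart x x).toLinearMap (dchart_bijective hxS)
  let β : EuclideanSpace ℝ (Fin m) →ₗ[ℝ] ℝ := α ∘ₗ e.symm.toLinearMap
  -- The function is linear in the chart at `x`.
  refine ⟨fun y => β.toContinuousLinearMap (extChartAt (𝓡 m) x y), ?_, ?_⟩
  · have h := contMDiffOn_extChartAt (I := 𝓡 m) (n := ∞) (x := x)
    exact (β.toContinuousLinearMap.contDiff.contMDiff).comp_contMDiffOn h
  · refine LinearMap.ext fun v => ?_
    rw [diff_comp_chart hxS β.toContinuousLinearMap.differentiableAt,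
      ContinuousLinearMap.fderiv]
    change α (e.symm (e v)) = α v
    rw [e.symm_apply_apply]

end Fields

/-! ### The action of the deformed pencil on the functions $Z_b(H^a(\lambda))$. -/

section Pencil

variable {n k : ℕ} {M : Type*} [TopologicalSpace M]
  [ChartedSpace (EuclideanSpace ℝ (Fin (2 * n + k))) M] [IsManifold (𝓡 (2 * n + k)) ∞ M]
  {P₁ P₀ : TensorField (2 * n + k) M} {𝒵 : ∀ x : M, Submodule ℝ (Tan (2 * n + k) x)}
  {N : Fin k → ℕ} {H : Fin k → ℕ → M → ℝ} {Z : Fin k → ∀ x : M, Tan (2 * n + k) x}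

lemma eq_zero_of_forall_sum_pow_eq_zero (K : ℕ) (a : ℕ → ℝ)
    (h : ∀ t : ℝ, ∑ j ∈ Finset.range (K + 1), t ^ (K - j) * a j = 0) : a 0 = 0 := by
  have hp : (∑ j ∈ Finset.range (K + 1), Polynomial.C (a j) * Polynomial.X ^ (K - j) : ℝ[X]) = 0 := by
    refine Polynomial.funext fun t => ?_
    rw [Polynomial.eval_finsetSum, Polynomial.eval_zero, ← h t]
    refine Finset.sum_congr rfl fun j _ => ?_
    rw [Polynomial.eval_mul, Polynomial.eval_C, Polynomial.eval_pow, Polynomial.eval_X, mul_comm]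
  have hc := congrArg (fun p => Polynomial.coeff p K) hp
  simp only [Polynomial.finsetSum_coeff, Polynomial.coeff_C_mul_X_pow, Polynomial.coeff_zero] at hc
  rw [Finset.sum_eq_single 0] at hc
  · simpa using hc
  · intro j hj hj0
    rw [if_neg]
    have := Finset.mem_range.1 hj
    omega
  · simp

lemma IsAffine.diffAt (hM : IsAffine P₁ P₀ 𝒵 N H Z) {a : Fin k} {j : ℕ} (hj : j ≤ N a) (x : M) :
    DiffAt (2 * n + k) (H a j) x :=
  (hM.smooth a j hj).diffAt isOpen_univ (Set.mem_univ x)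

lemma IsAffine.smoothOn_polyFun (hM : IsAffine P₁ P₀ 𝒵 N H Z) (a : Fin k) (t : ℝ) :
    SmoothOn (2 * n + k) (polyFun (N a) (H a) t) Set.univ := by
  refine contMDiffOn_finsetSum fun j hj => ?_
  exact contMDiffOn_const.mul (hM.smooth a j (Nat.lt_succ_iff.1 (Finset.mem_range.1 hj)))

lemma IsAffine.diff_polyFun (hM : IsAffine P₁ P₀ 𝒵 N H Z) (a : Fin k) (t : ℝ) (x : M) :
    diff (2 * n + k) (polyFun (N a) (H a) t) x
      = ∑ j ∈ Finset.range (N a + 1), t ^ (N a - j) • diff (2 * n + k) (H a j) x := by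
  have hd : ∀ j ∈ Finset.range (N a + 1), DiffAt (2 * n + k) (H a j) x := fun j hj =>
    hM.diffAt (Nat.lt_succ_iff.1 (Finset.mem_range.1 hj)) x
  refine (diff_sum _ fun j hj => (diffAt_const _ _).mul (hd j hj)).trans ?_
  exact Finset.sum_congr rfl fun j hj => diff_const_mul _ (hd j hj)

lemma IsAffine.ham_zero_casimir (hM : IsAffine P₁ P₀ 𝒵 N H Z) (c : Fin k) (x : M) :
    P₀ x (diff (2 * n + k) (H c 0) x) = 0 := by
  have h : diff (2 * n + k) (H c 0) x ∈ LinearMap.ker (P₀ x) := by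
    rw [← hM.complete.span x]
    exact Submodule.subset_span ⟨c, rfl⟩
  exact h

/-- The fields $X_c$ are the same for every member of the pencil; this is what makes the commutators
$[Z_b,X_c]$ free of $\lambda$. -/
lemma IsAffine.ham_pencil_casimir (hM : IsAffine P₁ P₀ 𝒵 N H Z) (c : Fin k) (t : ℝ) (x : M) :
    ham (pencil P₁ P₀ t) (H c 0) x = ham P₁ (H c 0) x := by
  simp [ham, pencil, hM.ham_zero_casimir c x]

/-- The leading coefficients of the polynomial Casimirs are in involution. -/
lemma IsAffine.involution (hM : IsAffine P₁ P₀ 𝒵 N H Z) (e c : Fin k) (x : M) :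
    diff (2 * n + k) (H e 0) x (ham P₁ (H c 0) x) = 0 := by
  -- Pairing the Casimir identity of $H^c(t)$ with $dH^e_0$ removes $P_0$ and leaves a polynomial in
  -- $t$ that vanishes identically; its top coefficient is the claim.
  refine eq_zero_of_forall_sum_pow_eq_zero (N c)
    (fun j => diff (2 * n + k) (H e 0) x (ham P₁ (H c j) x)) fun t => ?_
  have h := congrArg (diff (2 * n + k) (H e 0) x) (hM.casimir c t x)
  rw [ham, pencil, LinearMap.sub_apply, LinearMap.smul_apply, map_sub, map_smul, map_zero,
    hM.transversal.bihamiltonian.poisson_zero.skew x (diff (2 * n + k) (H e 0) x),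
    hM.ham_zero_casimir, map_zero, neg_zero, smul_zero, sub_zero, hM.diff_polyFun, map_sum,
    map_sum] at h
  rw [← h]
  refine Finset.sum_congr rfl fun j _ => ?_
  rw [map_smul, map_smul, smul_eq_mul, ham]

lemma IsAffine.mem_distribution (hM : IsAffine P₁ P₀ 𝒵 N H Z) (b : Fin k) (x : M) :
    Z b x ∈ 𝒵 x := by
  rw [← hM.generators x]
  exact Submodule.subset_span ⟨b, rfl⟩

/-- By normalization the covectors $dH^c_0$ read off the coefficients in the generators. In
particular a vector of $\mathcal Z$ annihilated by all of them is zero. -/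
lemma IsAffine.eq_sum_of_mem (hM : IsAffine P₁ P₀ 𝒵 N H Z) {x : M} {u : Tan (2 * n + k) x}
    (hu : u ∈ 𝒵 x) : u = ∑ c, diff (2 * n + k) (H c 0) x u • Z c x := by
  rw [← hM.generators x] at hu
  obtain ⟨w, rfl⟩ := (Submodule.mem_span_range_iff_exists_fun ℝ).1 hu
  refine Finset.sum_congr rfl fun c _ => ?_
  congr 1
  rw [map_sum, Finset.sum_eq_single c]
  · have h : diff (2 * n + k) (H c 0) x (Z c x) = _ := hM.normalized c c x
    rw [map_smul, h]; simp
  · intro d _ hdc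
    have h : diff (2 * n + k) (H c 0) x (Z d x) = _ := hM.normalized c d x
    rw [map_smul, h, if_neg (Ne.symm hdc), smul_zero]
  · simp

lemma IsAffine.isSmoothField_generator (hM : IsAffine P₁ P₀ 𝒵 N H Z) (b : Fin k) (U : Set M) :
    IsSmoothField (Z b) U :=
  isSmoothField_of_contMDiff (hM.smooth_generators b) U

lemma IsAffine.isSmoothField_ham_casimir (hM : IsAffine P₁ P₀ 𝒵 N H Z) (c : Fin k) (U : Set M) :
    IsSmoothField (ham P₁ (H c 0)) U :=
  (hM.transversal.bihamiltonian.poisson_one.isSmoothField_ham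
    (hM.complete.smooth c)).mono (Set.subset_univ U)

/-- The deformed pencil applied to the differentials of the entries of the matrix `D`. -/
theorem IsAffine.exists_ham_deformed_lie (hM : IsAffine P₁ P₀ 𝒵 N H Z) (x : M) :
    ∃ W : Fin k → Fin k → Tan (2 * n + k) x, ∀ (a b : Fin k) (t : ℝ),
      ham (deformed P₁ (fun c => H c 0) Z) (lie (Z b) (polyFun (N a) (H a) t)) x
        - t • ham P₀ (lie (Z b) (polyFun (N a) (H a) t)) x
        = - ∑ c, lie (Z c) (polyFun (N a) (H a) t) x • W c b := by
  -- The vectors are $[Z_b,X_c]$ at `x`, chosen before $a$ and $t$.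
  have hW : ∀ c b : Fin k, ∃ w : Tan (2 * n + k) x, ∀ (g : M → ℝ) (U' : Set M), IsOpen U' →
      x ∈ U' → SmoothOn (2 * n + k) g U' → diff (2 * n + k) g x w
        = lie (Z b) (lie (ham P₁ (H c 0)) g) x - lie (ham P₁ (H c 0)) (lie (Z b) g) x :=
    fun c b => exists_commutator isOpen_univ (hM.isSmoothField_generator b _)
      (hM.isSmoothField_ham_casimir c _) (Set.mem_univ x)
  choose W hW using hW
  refine ⟨W, fun a b t => ?_⟩
  have hT := hM.transversal
  have hskew := (hT.bihamiltonian.compatible t).skew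
  have hcas : ∀ e, SmoothOn (2 * n + k) (H e 0) Set.univ := hM.complete.smooth
  set h := polyFun (N a) (H a) t with hh
  have hsm : SmoothOn (2 * n + k) h Set.univ := hM.smoothOn_polyFun a t
  set g := lie (Z b) h with hg
  have hflat : ∀ c, diff (2 * n + k) g x (Z c x) = 0 := fun c => hM.flat a c b t x
  have hconst : ∀ e c (y : M), lie (Z c) (H e 0) y = if e = c then 1 else 0 := hM.normalized
  have hLconst : ∀ (V : ∀ x : M, Tan (2 * n + k) x) e c, lie V (lie (Z c) (H e 0)) x = 0 := by
    intro V e c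
    rw [lie_congr_on isOpen_univ (g := fun _ => if e = c then 1 else 0)
      (fun y _ => hconst e c y) (Set.mem_univ x), lie, diff_const, LinearMap.zero_apply]
  -- Flatness removes the half of $X_c\wedge Z_c$ that points along $X_c$.
  have hform : ham (deformed P₁ (fun c => H c 0) Z) g x - t • ham P₀ g x
      = ham (pencil P₁ P₀ t) g x
        + ∑ c, diff (2 * n + k) g x (ham P₁ (H c 0) x) • Z c x := by
    simp only [ham, deformed_apply, hflat, zero_smul, zero_sub, Finset.sum_neg_distrib, pencil,
      LinearMap.sub_apply, LinearMap.smul_apply]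
    abel
  rw [eq_neg_iff_add_eq_zero, hform]
  set E := ham (pencil P₁ P₀ t) g x + ∑ c, diff (2 * n + k) g x (ham P₁ (H c 0) x) • Z c x
    + ∑ c, lie (Z c) h x • W c b with hE
  obtain ⟨U, f, hU, hxU, hf, hfU⟩ := hT.integrable x
  have hinv : ∀ i, InvariantOn 𝒵 (f i) U := by
    intro i y hy v hv
    rw [(hfU y hy).2, Submodule.mem_iInf] at hv
    exact hv i
  have hZf : ∀ i c, ∀ y ∈ U, lie (Z c) (f i) y = 0 := fun i c y hy =>
    hinv i y hy _ (hM.mem_distribution c y)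
  have hVZf : ∀ (V : ∀ x : M, Tan (2 * n + k) x) i c, lie V (lie (Z c) (f i)) x = 0 := by
    intro V i c
    rw [lie_congr_on hU (g := fun _ => 0) (hZf i c) hxU, lie, diff_const, LinearMap.zero_apply]
  -- It suffices to show that the local invariants `f i` cutting out $\mathcal Z$ have zero
  -- derivative along `E`.
  have hEZ : E ∈ 𝒵 x := by
    rw [(hfU x hxU).2, Submodule.mem_iInf]
    intro i
    have hV : IsSmoothField (ham (pencil P₁ P₀ t) (f i)) U :=
      (hT.bihamiltonian.compatible t).isSmoothField_ham (hf i)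
    obtain ⟨u, hu⟩ := exists_commutator hU (hM.isSmoothField_generator b U) hV hxU
    -- Here `u` is $[Z_b,P_t\,df_i]$; it annihilates each $f_j$ since $\{f_j,f_i\}$ is again
    -- invariant.
    have huZ : u ∈ 𝒵 x := by
      rw [(hfU x hxU).2, Submodule.mem_iInf]
      intro j
      rw [LinearMap.mem_ker, hu (f j) U hU hxU (hf j), hVZf, sub_zero]
      exact hT.subalgebra t U (f j) (f i) hU (hf j) (hf i) (hinv j) (hinv i) x hxU _
        (hM.mem_distribution b x)
    have huH : ∀ c, diff (2 * n + k) (H c 0) x u = - lie (Z b) (lie (ham P₁ (H c 0)) (f i)) x := by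
      intro c
      rw [hu (H c 0) Set.univ isOpen_univ (Set.mem_univ x) (hcas c), hLconst, sub_zero,
        lie_congr_on hU (g := fun y => - lie (ham P₁ (H c 0)) (f i) y) _ hxU]
      · rw [lie, diff_neg]; rfl
      · intro y _
        rw [lie_ham_eq_neg hskew, lie, lie, hM.ham_pencil_casimir]
    -- Since `h` is a Casimir of the pencil at `t`, $P_t\,df_i$ annihilates it and only the term
    -- $-P_t\,df_i(Z_b h)$ of the commutator survives.
    have huh : diff (2 * n + k) h x u = diff (2 * n + k) (f i) x (ham (pencil P₁ P₀ t) g x) := by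
      rw [hu h Set.univ isOpen_univ (Set.mem_univ x) hsm,
        lie_congr_on hU (g := fun _ => 0) _ hxU]
      · rw [lie_ham_eq_neg hskew, lie, diff_const, LinearMap.zero_apply, zero_sub, neg_neg]
        rfl
      · intro y _
        rw [lie_ham_eq_neg hskew, lie, hM.casimir, map_zero, neg_zero]
    have hsum := congrArg (diff (2 * n + k) h x) (hM.eq_sum_of_mem huZ)
    rw [huh, map_sum] at hsum
    have h0 : ∀ c, diff (2 * n + k) (f i) x (Z c x) = 0 := fun c => hZf i c x hxU
    rw [LinearMap.mem_ker, hE, map_add, map_add, map_sum, map_sum, hsum]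
    simp only [map_smul, smul_eq_mul, h0, mul_zero, Finset.sum_const_zero, add_zero, huH,
      hW _ _ (f i) U hU hxU (hf i), hVZf, sub_zero]
    rw [← Finset.sum_add_distrib]
    refine Finset.sum_eq_zero fun c _ => ?_
    rw [show diff (2 * n + k) h x (Z c x) = lie (Z c) h x from rfl]; ring
  -- Skew-symmetry turns the first term of `E` into $-dg(X_e)$, which cancels the second by
  -- normalization. The commutators contribute nothing, because $X_c(H^e_0)=0$ and $Z_b(H^e_0)$ is
  -- constant.
  have hEH : ∀ e, diff (2 * n + k) (H e 0) x E = 0 := by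
    intro e
    have h1 : diff (2 * n + k) (H e 0) x (ham (pencil P₁ P₀ t) g x)
        = - diff (2 * n + k) g x (ham P₁ (H e 0) x) := by
      rw [← hM.ham_pencil_casimir e t x]
      exact hskew _ _ _
    have h2 : ∀ c, diff (2 * n + k) (H e 0) x (Z c x) = if e = c then 1 else 0 :=
      fun c => hconst e c x
    have h3 : ∀ c, diff (2 * n + k) (H e 0) x (W c b) = 0 := by
      intro c
      rw [hW c b (H e 0) Set.univ isOpen_univ (Set.mem_univ x) (hcas e), hLconst, sub_zero,
        lie_congr_on isOpen_univ (f := lie (ham P₁ (H c 0)) (H e 0)) (g := fun _ => 0)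
          (fun y _ => hM.involution e c y)
        (Set.mem_univ x), lie, diff_const, LinearMap.zero_apply]
    rw [hE, map_add, map_add, map_sum, map_sum, h1]
    simp [h2, h3]
  rw [hM.eq_sum_of_mem hEZ]
  exact Finset.sum_eq_zero fun c _ => by rw [hEH c, zero_smul]

end Pencil

/-! ### Derivations of determinants and adjugates; leading coefficients of determinants. -/

section Algebra

variable {R S ι : Type*} [CommRing R] [CommRing S] [Fintype ι] [DecidableEq ι]

/-- A derivation of `R` with values in `S`, where `R` acts on `S` through `ev`. -/
def IsDeriv (ev : R →+* S) (δ : R →+ S) : Prop :=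
  ∀ a b, δ (a * b) = ev a * δ b + ev b * δ a

lemma IsDeriv.one {ev : R →+* S} {δ : R →+ S} (h : IsDeriv ev δ) : δ 1 = 0 := by
  have := h 1 1
  simpa using this

lemma IsDeriv.prod {κ : Type*} [DecidableEq κ] {ev : R →+* S} {δ : R →+ S} (h : IsDeriv ev δ)
    (s : Finset κ) (f : κ → R) :
    δ (∏ i ∈ s, f i) = ∑ i ∈ s, (∏ j ∈ s.erase i, ev (f j)) * δ (f i) := by
  induction s using Finset.induction_on with
  | empty => simpa using h.one
  | insert a s ha ih =>
    rw [Finset.prod_insert ha, h, ih, Finset.sum_insert ha, Finset.erase_insert ha, map_prod,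
      add_comm, Finset.mul_sum]
    congr 1
    refine Finset.sum_congr rfl fun i hi => ?_
    have hia : a ≠ i := fun e => ha (e ▸ hi)
    rw [Finset.erase_insert_of_ne hia, Finset.prod_insert (by simp [ha]), mul_assoc]

/-- Jacobi's formula for the derivative of a determinant. -/
lemma IsDeriv.det {ev : R →+* S} {δ : R →+ S} (h : IsDeriv ev δ) (A : Matrix ι ι R) :
    δ A.det = ((A.map ev).adjugate * A.map δ).trace := by
  -- The Leibniz rule differentiates one column at a time; each resulting determinant is then a
  -- Cramer coefficient.
  have h1 : δ A.det = ∑ i, ((A.map ev).updateCol i fun j => δ (A j i)).det := by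
    simp only [Matrix.det_apply, map_sum]
    rw [Finset.sum_comm]
    refine Finset.sum_congr rfl fun σ _ => ?_
    rw [← Finset.smul_sum, Units.smul_def, Units.smul_def, map_zsmul, h.prod]
    congr 1
    refine Finset.sum_congr rfl fun i _ => ?_
    rw [← Finset.prod_erase_mul _ _ (Finset.mem_univ i), Matrix.updateCol_self]
    congr 1
    refine Finset.prod_congr rfl fun j hj => ?_
    rw [Matrix.updateCol_ne (Finset.ne_of_mem_erase hj), Matrix.map_apply]
  rw [h1, Matrix.trace]
  refine Finset.sum_congr rfl fun i _ => ?_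
  rw [← Matrix.cramer_apply, Matrix.cramer_eq_adjugate_mulVec]
  rfl

lemma IsDeriv.map_mul {ι : Type*} [Fintype ι] {ev : R →+* S} {δ : R →+ S} (h : IsDeriv ev δ) (A B : Matrix ι ι R) :
    (A * B).map δ = A.map ev * B.map δ + A.map δ * B.map ev := by
  ext i j
  simp only [Matrix.map_apply, Matrix.mul_apply, Matrix.add_apply, map_sum, h _ _,
    ← Finset.sum_add_distrib]
  exact Finset.sum_congr rfl fun c _ => by ring

lemma IsDeriv.det_of_map_eq {ev : R →+* S} {δ : R →+ S} (h : IsDeriv ev δ) {A : Matrix ι ι R}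
    {Ω : Matrix ι ι S} (hA : A.map δ = -(A.map ev * Ω)) :
    δ A.det = -((A.map ev).det * Ω.trace) := by
  rw [h.det, hA, Matrix.mul_neg, ← Matrix.mul_assoc, Matrix.adjugate_mul, Matrix.smul_mul,
    Matrix.one_mul, Matrix.trace_neg, Matrix.trace_smul, smul_eq_mul]

/-- Apply the derivation to $\operatorname{adj}A\cdot A=\det A\cdot 1$, multiply on the right by the
adjugate, and cancel the nonzero determinant. -/
lemma IsDeriv.adjugate_of_map_eq [IsDomain S] {ev : R →+* S} {δ : R →+ S} (h : IsDeriv ev δ)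
    {A : Matrix ι ι R} {Ω : Matrix ι ι S} (hA : A.map δ = -(A.map ev * Ω))
    (hdet : (A.map ev).det ≠ 0) :
    A.adjugate.map δ = (Ω - Ω.trace • (1 : Matrix ι ι S)) * (A.map ev).adjugate := by
  have h0 : A.adjugate.map ev = (A.map ev).adjugate := by
    have := ev.map_adjugate A
    simpa only [RingHom.mapMatrix_apply] using this
  have h1 := h.map_mul A.adjugate A
  have h2 : (A.adjugate * A).map δ = δ A.det • (1 : Matrix ι ι S) := by
    rw [Matrix.adjugate_mul]
    ext i j
    simp only [Matrix.map_apply, Matrix.smul_apply, Matrix.one_apply, smul_eq_mul, mul_ite,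
      mul_one, mul_zero]
    split_ifs <;> simp
  rw [h2, h0, h.det_of_map_eq hA, hA, Matrix.mul_neg, ← Matrix.mul_assoc, Matrix.adjugate_mul,
    Matrix.smul_mul, Matrix.one_mul] at h1
  have h3 : A.adjugate.map δ * A.map ev
      = (A.map ev).det • (Ω - Ω.trace • (1 : Matrix ι ι S)) := by
    rw [smul_sub, smul_smul, sub_eq_add_neg, ← neg_smul, h1]
    abel
  have h4 := congrArg (fun B => B * (A.map ev).adjugate) h3
  simp only [Matrix.mul_assoc, Matrix.mul_adjugate, Matrix.smul_mul, Matrix.mul_smul,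
    Matrix.mul_one] at h4
  ext i j
  have h5 := congrFun (congrFun h4 i) j
  simp only [Matrix.smul_apply, smul_eq_mul] at h5
  exact mul_left_cancel₀ hdet h5

/-- The `2 × 2` minors of the adjugate of a singular matrix vanish. -/
lemma adjugate_mul_eq_of_det_eq_zero [IsDomain S] {A : Matrix ι ι S} (hA : A.det = 0)
    {a c : ι} (hac : A.adjugate a c ≠ 0) (b e : ι) :
    A.adjugate a c * A.adjugate e b = A.adjugate a b * A.adjugate e c := by
  -- This combination of columns `b` and `c` of the adjugate lies in the kernel of `A`, and its
  -- entry at `a` is zero.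
  set z : ι → S := fun i => A.adjugate a c * A.adjugate i b - A.adjugate a b * A.adjugate i c
    with hz
  have hmul : ∀ i j, ∑ l, A i l * A.adjugate l j = 0 := by
    intro i j
    have := congrFun (congrFun (Matrix.mul_adjugate A) i) j
    simpa [Matrix.mul_apply, hA] using this
  have hAz : A.mulVec z = 0 := by
    ext i
    simp only [Matrix.mulVec, dotProduct, hz, mul_sub, Finset.sum_sub_distrib, Pi.zero_apply,
      mul_left_comm (A i _), ← Finset.mul_sum, hmul, mul_zero, sub_zero]
  -- The matrix with row `c` replaced by the unit vector at `a` has determinant `A.adjugate a c`,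
  -- which is nonzero, so `z` must vanish.
  have hz0 : (A.updateRow c (Pi.single a 1)).mulVec z = 0 := by
    ext i
    by_cases hi : i = c
    · subst hi
      simp [Matrix.mulVec, hz]
      ring
    · have := congrFun hAz i
      simpa [Matrix.mulVec, Matrix.updateRow_ne hi] using this
  have h := Matrix.eq_zero_of_mulVec_eq_zero (by rwa [← Matrix.adjugate_apply]) hz0
  exact sub_eq_zero.1 (congrFun h e)

lemma coeff_prod_of_natDegree_le {κ : Type*} (s : Finset κ) (f : κ → S[X]) (d : κ → ℕ)
    (h : ∀ i ∈ s, (f i).natDegree ≤ d i) :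
    (∏ i ∈ s, f i).coeff (∑ i ∈ s, d i) = ∏ i ∈ s, (f i).coeff (d i) := by
  classical
  induction s using Finset.induction_on with
  | empty => simp
  | insert a s ha ih =>
    rw [Finset.prod_insert ha, Finset.sum_insert ha, Finset.prod_insert ha,
      Polynomial.coeff_mul_add_eq_of_natDegree_le (h a (by simp)), ih fun i hi => h i (by simp [hi])]
    exact (Polynomial.natDegree_prod_le _ _).trans
      (Finset.sum_le_sum fun i hi => h i (by simp [hi]))

lemma natDegree_det_le {A : Matrix ι ι S[X]} (d : ι → ℕ) (h : ∀ i j, (A i j).natDegree ≤ d i) :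
    A.det.natDegree ≤ ∑ i, d i := by
  rw [Matrix.det_apply]
  refine Polynomial.natDegree_sum_le_of_forall_le _ _ fun σ _ => ?_
  rw [Units.smul_def]
  refine (Polynomial.natDegree_smul_le _ _).trans ((Polynomial.natDegree_prod_le _ _).trans ?_)
  rw [← Equiv.sum_comp σ d]
  exact Finset.sum_le_sum fun i _ => h _ _

/-- Each product in the Leibniz expansion takes one entry from every row, so its coefficient at the
sum of the row bounds is the product of the row-leading coefficients. -/
lemma coeff_det_sum {A : Matrix ι ι S[X]} (d : ι → ℕ) (h : ∀ i j, (A i j).natDegree ≤ d i) :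
    A.det.coeff (∑ i, d i) = (Matrix.of fun i j => (A i j).coeff (d i)).det := by
  rw [Matrix.det_apply, Matrix.det_apply, Polynomial.finsetSum_coeff]
  refine Finset.sum_congr rfl fun σ _ => ?_
  rw [Units.smul_def, Units.smul_def, Polynomial.coeff_smul, ← Equiv.sum_comp σ d,
    coeff_prod_of_natDegree_le _ _ (fun i => d (σ i)) fun i _ => h _ _]
  rfl

end Algebra

/-! ### Families of polynomials and their coefficientwise differentiation. -/

section Families

variable {m : ℕ} {M : Type*} [TopologicalSpace M] [ChartedSpace (EuclideanSpace ℝ (Fin m)) M]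

/-- The ring of families of polynomials of bounded degree whose coefficients are differentiable
at `x`. -/
def family (m : ℕ) {M : Type*} [TopologicalSpace M] [ChartedSpace (EuclideanSpace ℝ (Fin m)) M]
    (x : M) : Subring (M → ℝ[X]) where
  carrier := {Q | (∃ K, ∀ y, (Q y).natDegree ≤ K) ∧ ∀ j, DiffAt m (fun y => (Q y).coeff j) x}
  mul_mem' := by
    rintro P Q ⟨⟨K, hK⟩, hP⟩ ⟨⟨L, hL⟩, hQ⟩
    refine ⟨⟨K + L, fun y => Polynomial.natDegree_mul_le_of_le (hK y) (hL y)⟩, fun j => ?_⟩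
    simp only [Pi.mul_apply, Polynomial.coeff_mul]
    exact DiffAt.sum _ fun p _ => (hP _).mul (hQ _)
  one_mem' := ⟨⟨0, fun y => by simp⟩, fun j => diffAt_const _ x⟩
  add_mem' := by
    rintro P Q ⟨⟨K, hK⟩, hP⟩ ⟨⟨L, hL⟩, hQ⟩
    refine ⟨⟨max K L, fun y => Polynomial.natDegree_add_le_of_le (hK y) (hL y)⟩, fun j => ?_⟩
    simp only [Pi.add_apply, Polynomial.coeff_add]
    exact MDifferentiableAt.add (hP j) (hQ j)
  zero_mem' := ⟨⟨0, fun y => by simp⟩, fun j => diffAt_const _ x⟩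
  neg_mem' := by
    rintro P ⟨⟨K, hK⟩, hP⟩
    refine ⟨⟨K, fun y => by simpa using hK y⟩, fun j => ?_⟩
    simp only [Pi.neg_apply, Polynomial.coeff_neg]
    exact MDifferentiableAt.neg (hP j)

/-- The value of a family of polynomials at a point. -/
def famEval (x y : M) : family m x →+* ℝ[X] := (Pi.evalRingHom _ y).comp (family m x).subtype

/-- The functional `ℓ` on covectors at `x`, applied to the differentials at `x` of the
coefficients of a family of polynomials. -/
def famDerivFun {x : M} (ℓ : Module.Dual ℝ (Tan m x) →ₗ[ℝ] ℝ) (Q : family m x) : ℝ[X] :=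
  ∑ j ∈ Finset.range (Q.2.1.choose + 1),
    Polynomial.monomial j (ℓ (diff m (fun y => (Q.1 y).coeff j) x))

/-- The chosen degree bound is immaterial: beyond it the coefficient functions are identically zero,
and so are their differentials. -/
lemma coeff_famDerivFun {x : M} (ℓ : Module.Dual ℝ (Tan m x) →ₗ[ℝ] ℝ) (Q : family m x) (i : ℕ) :
    (famDerivFun ℓ Q).coeff i = ℓ (diff m (fun y => (Q.1 y).coeff i) x) := by
  simp only [famDerivFun, Polynomial.finsetSum_coeff, Polynomial.coeff_monomial,
    Finset.sum_ite_eq', Finset.mem_range]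
  split_ifs with h
  · rfl
  · have : (fun y => (Q.1 y).coeff i) = fun _ => 0 := funext fun y =>
      Polynomial.coeff_eq_zero_of_natDegree_lt
        (lt_of_le_of_lt (Q.2.1.choose_spec y) (by omega))
    rw [this, diff_const, map_zero]

/-- The additive map `famDerivFun ℓ`. -/
def famDeriv {x : M} (ℓ : Module.Dual ℝ (Tan m x) →ₗ[ℝ] ℝ) : family m x →+ ℝ[X] :=
  AddMonoidHom.mk' (famDerivFun ℓ) fun P Q => by
    ext i
    rw [Polynomial.coeff_add, coeff_famDerivFun, coeff_famDerivFun, coeff_famDerivFun, ← map_add,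
      ← diff_add (P.2.2 i) (Q.2.2 i)]
    rfl

lemma coeff_famDeriv {x : M} (ℓ : Module.Dual ℝ (Tan m x) →ₗ[ℝ] ℝ) (Q : family m x) (i : ℕ) :
    (famDeriv ℓ Q).coeff i = ℓ (diff m (fun y => (Q.1 y).coeff i) x) :=
  coeff_famDerivFun ℓ Q i

lemma isDeriv_famDeriv {x : M} (ℓ : Module.Dual ℝ (Tan m x) →ₗ[ℝ] ℝ) :
    IsDeriv (famEval x x) (famDeriv ℓ) := by
  intro P Q
  ext i
  rw [coeff_famDeriv, Polynomial.coeff_add]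
  have h : (fun y => ((P * Q).1 y).coeff i) = fun y => ∑ p ∈ Finset.HasAntidiagonal.antidiagonal i,
      (P.1 y).coeff p.1 * (Q.1 y).coeff p.2 := funext fun y => Polynomial.coeff_mul _ _ _
  rw [h, diff_sum _ fun p _ => (P.2.2 _).mul (Q.2.2 _), map_sum, mul_comm (famEval x x Q),
    Polynomial.coeff_mul, Polynomial.coeff_mul, ← Finset.sum_add_distrib]
  refine Finset.sum_congr rfl fun p _ => ?_
  rw [diff_mul (P.2.2 _) (Q.2.2 _), map_add, map_smul, map_smul, coeff_famDeriv, coeff_famDeriv,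
    smul_eq_mul, smul_eq_mul, mul_comm (ℓ _) ((famEval x x Q).coeff p.2)]
  rfl

lemma natDegree_famDeriv_le {x : M} (ℓ : Module.Dual ℝ (Tan m x) →ₗ[ℝ] ℝ) (Q : family m x) {K : ℕ}
    (hK : ∀ y, (Q.1 y).natDegree ≤ K) : (famDeriv ℓ Q).natDegree ≤ K := by
  refine Polynomial.natDegree_le_iff_coeff_eq_zero.2 fun i hi => ?_
  have : (fun y => (Q.1 y).coeff i) = fun _ => 0 := funext fun y =>
    Polynomial.coeff_eq_zero_of_natDegree_lt (lt_of_le_of_lt (hK y) hi)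
  rw [coeff_famDeriv, this, diff_const, map_zero]

/-- This links the polynomial identities to the tensor identities at each fixed real $\lambda$. -/
lemma eval_famDeriv {x : M} (ℓ : Module.Dual ℝ (Tan m x) →ₗ[ℝ] ℝ) (Q : family m x) (t : ℝ) :
    (famDeriv ℓ Q).eval t = ℓ (diff m (fun y => (Q.1 y).eval t) x) := by
  obtain ⟨K, hK⟩ := Q.2.1
  have h : (fun y => (Q.1 y).eval t)
      = fun y => ∑ j ∈ Finset.range (K + 1), t ^ j * (Q.1 y).coeff j := by
    funext y
    rw [Polynomial.eval_eq_sum_range' (Nat.lt_succ_of_le (hK y))]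
    exact Finset.sum_congr rfl fun j _ => mul_comm _ _
  have hd : (famDeriv ℓ Q).natDegree < K + 1 := Nat.lt_succ_of_le (natDegree_famDeriv_le ℓ Q hK)
  rw [h, diff_sum _ fun j _ => (diffAt_const _ x).mul (Q.2.2 j), map_sum,
    Polynomial.eval_eq_sum_range' hd]
  refine Finset.sum_congr rfl fun j _ => ?_
  rw [diff_const_mul _ (Q.2.2 j), map_smul, smul_eq_mul, coeff_famDeriv, mul_comm]

/-- The coefficientwise differentiated family. -/
def famDerivative {x : M} (Q : family m x) : family m x :=
  ⟨fun y => Polynomial.derivative (Q.1 y), by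
    obtain ⟨K, hK⟩ := Q.2.1
    refine ⟨⟨K, fun y => ?_⟩, fun j => ?_⟩
    · exact (Polynomial.natDegree_derivative_le _).trans ((Nat.sub_le _ _).trans (hK y))
    · simp only [Polynomial.coeff_derivative]
      exact (Q.2.2 _).mul (diffAt_const _ x)⟩

lemma famDeriv_famDerivative {x : M} (ℓ : Module.Dual ℝ (Tan m x) →ₗ[ℝ] ℝ) (Q : family m x) :
    famDeriv ℓ (famDerivative Q) = Polynomial.derivative (famDeriv ℓ Q) := by
  ext i
  rw [coeff_famDeriv, Polynomial.coeff_derivative, coeff_famDeriv]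
  have h : (fun y => ((famDerivative Q).1 y).coeff i)
      = fun y => ((i : ℝ) + 1) * (Q.1 y).coeff (i + 1) := funext fun y => by
    rw [mul_comm]
    exact Polynomial.coeff_derivative _ _
  rw [h, diff_const_mul _ (Q.2.2 _), map_smul, smul_eq_mul, mul_comm]

/-- The derivation of the ring of families attached to the pencil `ℓ₁ - X ℓ₀`. -/
def pencilDeriv {x : M} (ℓ₁ ℓ₀ : Module.Dual ℝ (Tan m x) →ₗ[ℝ] ℝ) : family m x →+ ℝ[X] :=
  famDeriv ℓ₁ - (AddMonoidHom.mulLeft Polynomial.X).comp (famDeriv ℓ₀)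

lemma pencilDeriv_apply {x : M} (ℓ₁ ℓ₀ : Module.Dual ℝ (Tan m x) →ₗ[ℝ] ℝ) (Q : family m x) :
    pencilDeriv ℓ₁ ℓ₀ Q = famDeriv ℓ₁ Q - Polynomial.X * famDeriv ℓ₀ Q := rfl

lemma isDeriv_pencilDeriv {x : M} (ℓ₁ ℓ₀ : Module.Dual ℝ (Tan m x) →ₗ[ℝ] ℝ) :
    IsDeriv (famEval x x) (pencilDeriv ℓ₁ ℓ₀) := by
  intro P Q
  simp only [pencilDeriv_apply, isDeriv_famDeriv ℓ₁ P Q, isDeriv_famDeriv ℓ₀ P Q]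
  ring

end Families

/-! ### Complex-valued functions and the chain rule along a root. -/

section ComplexFunctions

variable {m : ℕ} {M : Type*} [TopologicalSpace M] [ChartedSpace (EuclideanSpace ℝ (Fin m)) M]

/-- The complex function `f` is real differentiable at `x`. -/
abbrev CDiffAt (m : ℕ) {M : Type*} [TopologicalSpace M]
    [ChartedSpace (EuclideanSpace ℝ (Fin m)) M] (f : M → ℂ) (x : M) : Prop :=
  MDifferentiableAt (𝓡 m) 𝓘(ℝ, ℂ) f x

/-- The complex linear extension of the functional `ℓ` on covectors at `x`, applied to the
differential of a complex function. -/
def lieC {x : M} (ℓ : Module.Dual ℝ (Tan m x) →ₗ[ℝ] ℝ) (f : M → ℂ) : ℂ :=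
  (ℓ (diff m (fun y => (f y).re) x) : ℂ) + (ℓ (diff m (fun y => (f y).im) x) : ℂ) * Complex.I

variable {x : M}

lemma CDiffAt.re {f : M → ℂ} (hf : CDiffAt m f x) : DiffAt m (fun y => (f y).re) x :=
  MDifferentiableAt.comp (g := Complex.reCLM) x
    Complex.reCLM.differentiableAt.mdifferentiableAt hf

lemma CDiffAt.im {f : M → ℂ} (hf : CDiffAt m f x) : DiffAt m (fun y => (f y).im) x :=
  MDifferentiableAt.comp (g := Complex.imCLM) x
    Complex.imCLM.differentiableAt.mdifferentiableAt hf

lemma cdiffAt_const (c : ℂ) : CDiffAt m (fun _ : M => c) x := mdifferentiableAt_const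

lemma DiffAt.ofReal {f : M → ℝ} (hf : DiffAt m f x) : CDiffAt m (fun y => (f y : ℂ)) x :=
  MDifferentiableAt.comp (g := Complex.ofRealCLM) x
    Complex.ofRealCLM.differentiableAt.mdifferentiableAt hf

lemma CDiffAt.add {f g : M → ℂ} (hf : CDiffAt m f x) (hg : CDiffAt m g x) :
    CDiffAt m (fun y => f y + g y) x := MDifferentiableAt.add hf hg

lemma CDiffAt.mul {f g : M → ℂ} (hf : CDiffAt m f x) (hg : CDiffAt m g x) :
    CDiffAt m (fun y => f y * g y) x := MDifferentiableAt.mul hf hg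

lemma CDiffAt.pow {f : M → ℂ} (hf : CDiffAt m f x) (j : ℕ) :
    CDiffAt m (fun y => f y ^ j) x := by
  induction j with
  | zero => simpa using cdiffAt_const 1
  | succ j ih => simpa only [pow_succ] using ih.mul hf

lemma CDiffAt.inv {f : M → ℂ} (hf : CDiffAt m f x) (h0 : f x ≠ 0) :
    CDiffAt m (fun y => (f y)⁻¹) x :=
  MDifferentiableAt.comp (g := fun z : ℂ => z⁻¹) x
    ((differentiableAt_inv (𝕜 := ℂ) h0).restrictScalars ℝ).mdifferentiableAt hf

lemma CDiffAt.sum {ι : Type*} (s : Finset ι) {f : ι → M → ℂ}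
    (hf : ∀ i ∈ s, CDiffAt m (f i) x) : CDiffAt m (fun y => ∑ i ∈ s, f i y) x := by
  classical
  induction s using Finset.induction_on with
  | empty => simpa using cdiffAt_const (0 : ℂ)
  | insert a s ha ih =>
    simp only [Finset.sum_insert ha]
    exact CDiffAt.add (hf a (by simp)) (ih fun i hi => hf i (by simp [hi]))

variable (ℓ : Module.Dual ℝ (Tan m x) →ₗ[ℝ] ℝ)

lemma lieC_congr {f g : M → ℂ} (h : f =ᶠ[nhds x] g) : lieC ℓ f = lieC ℓ g := by
  unfold lieC
  rw [diff_congr (f := fun y => (f y).re) (h.fun_comp Complex.re),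
    diff_congr (f := fun y => (f y).im) (h.fun_comp Complex.im)]
  rfl

lemma lieC_const (c : ℂ) : lieC ℓ (fun _ => c) = 0 := by
  simp [lieC, diff_const]

lemma lieC_ofReal (f : M → ℝ) : lieC ℓ (fun y => (f y : ℂ)) = ℓ (diff m f x) := by
  simp [lieC, diff_const]

lemma lieC_add {f g : M → ℂ} (hf : CDiffAt m f x) (hg : CDiffAt m g x) :
    lieC ℓ (fun y => f y + g y) = lieC ℓ f + lieC ℓ g := by
  simp only [lieC, Complex.add_re, Complex.add_im, diff_add hf.re hg.re, diff_add hf.im hg.im,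
    map_add]
  push_cast
  ring

lemma lieC_mul {f g : M → ℂ} (hf : CDiffAt m f x) (hg : CDiffAt m g x) :
    lieC ℓ (fun y => f y * g y) = f x * lieC ℓ g + g x * lieC ℓ f := by
  simp only [lieC, Complex.mul_re, Complex.mul_im,
    diff_sub (hf.re.mul hg.re) (hf.im.mul hg.im), diff_add (hf.re.mul hg.im) (hf.im.mul hg.re),
    diff_mul hf.re hg.re, diff_mul hf.im hg.im, diff_mul hf.re hg.im, diff_mul hf.im hg.re,
    map_add, map_sub, map_smul, smul_eq_mul]
  conv_rhs => rw [← Complex.re_add_im (f x), ← Complex.re_add_im (g x)]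
  push_cast
  linear_combination (-((f x).im * (ℓ (diff m (fun y => (g y).im) x) : ℂ))
    - (g x).im * (ℓ (diff m (fun y => (f y).im) x) : ℂ)) * Complex.I_sq

lemma lieC_pow {f : M → ℂ} (hf : CDiffAt m f x) (j : ℕ) :
    lieC ℓ (fun y => f y ^ j) = j * f x ^ (j - 1) * lieC ℓ f := by
  induction j with
  | zero => simpa using lieC_const ℓ 1
  | succ j ih =>
    simp only [pow_succ]
    rw [lieC_mul ℓ (hf.pow j) hf, ih]
    -- The truncated exponent `j - 1` needs the case of the first power apart.
    rcases j with _ | j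
    · simp
    · simp only [Nat.add_sub_cancel]
      push_cast
      ring

lemma lieC_sum {ι : Type*} (s : Finset ι) {f : ι → M → ℂ} (hf : ∀ i ∈ s, CDiffAt m (f i) x) :
    lieC ℓ (fun y => ∑ i ∈ s, f i y) = ∑ i ∈ s, lieC ℓ (f i) := by
  classical
  induction s using Finset.induction_on with
  | empty => simpa using lieC_const ℓ 0
  | insert a s ha ih =>
    simp only [Finset.sum_insert ha]
    rw [lieC_add ℓ (hf a (by simp)) (CDiffAt.sum s fun i hi => hf i (by simp [hi])),
      ih fun i hi => hf i (by simp [hi])]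

lemma family_aeval_eq (Q : family m x) {K : ℕ} (hK : ∀ y, (Q.1 y).natDegree ≤ K) (r : M → ℂ) :
    (fun y => Polynomial.aeval (r y) (Q.1 y))
      = fun y => ∑ j ∈ Finset.range (K + 1), ((Q.1 y).coeff j : ℂ) * r y ^ j := by
  funext y
  rw [Polynomial.aeval_eq_sum_range' (Nat.lt_succ_of_le (hK y))]
  exact Finset.sum_congr rfl fun j _ => Complex.real_smul

lemma cdiffAt_aeval (Q : family m x) {r : M → ℂ} (hr : CDiffAt m r x) :
    CDiffAt m (fun y => Polynomial.aeval (r y) (Q.1 y)) x := by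
  obtain ⟨K, hK⟩ := Q.2.1
  rw [family_aeval_eq Q hK]
  exact CDiffAt.sum _ fun j _ => (Q.2.2 j).ofReal.mul (hr.pow j)

/-- The chain rule for the value of a family of polynomials at a function. -/
lemma lieC_aeval (Q : family m x) {r : M → ℂ} (hr : CDiffAt m r x) :
    lieC ℓ (fun y => Polynomial.aeval (r y) (Q.1 y))
      = Polynomial.aeval (r x) (famDeriv ℓ Q)
        + Polynomial.aeval (r x) (Polynomial.derivative (Q.1 x)) * lieC ℓ r := by
  obtain ⟨K, hK⟩ := Q.2.1
  have hd : (famDeriv ℓ Q).natDegree < K + 1 := Nat.lt_succ_of_le (natDegree_famDeriv_le ℓ Q hK)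
  rw [family_aeval_eq Q hK, lieC_sum ℓ _ fun j _ => (Q.2.2 j).ofReal.mul (hr.pow j),
    Polynomial.aeval_eq_sum_range' hd]
  conv_rhs => rw [Polynomial.as_sum_range' (Q.1 x) _ (Nat.lt_succ_of_le (hK x))]
  rw [Polynomial.derivative_sum, map_sum, Finset.sum_mul, ← Finset.sum_add_distrib]
  refine Finset.sum_congr rfl fun j _ => ?_
  rw [lieC_mul ℓ (Q.2.2 j).ofReal (hr.pow j), lieC_pow ℓ hr, lieC_ofReal, coeff_famDeriv,
    Polynomial.derivative_monomial, Polynomial.aeval_monomial, Complex.real_smul]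
  simp only [Complex.coe_algebraMap]
  push_cast
  ring

/-- Real covectors separate tangent vectors, so an identity in the complexified tangent space can be
tested on the real and imaginary parts against each covector. -/
lemma hamC_eq_smul_of_forall {P Q : TensorField m M} {f : M → ℂ} (c : ℂ)
    (h : ∀ α : Module.Dual ℝ (Tan m x), lieC (α ∘ₗ P x) f = c * lieC (α ∘ₗ Q x) f) :
    hamC P f x = c • hamC Q f x := by
  have hre : ham P (fun y => (f y).re) x
      = c.re • ham Q (fun y => (f y).re) x - c.im • ham Q (fun y => (f y).im) x := by
    refine (Module.forall_dual_apply_eq_zero_iff ℝ _).1 (fun α => ?_) |> sub_eq_zero.1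
    have := congrArg Complex.re (h α)
    simp [lieC] at this
    simp only [map_sub, map_smul, ham, smul_eq_mul]
    linarith
  have him : ham P (fun y => (f y).im) x
      = c.im • ham Q (fun y => (f y).re) x + c.re • ham Q (fun y => (f y).im) x := by
    refine (Module.forall_dual_apply_eq_zero_iff ℝ _).1 (fun α => ?_) |> sub_eq_zero.1
    have := congrArg Complex.im (h α)
    simp [lieC] at this
    simp only [map_sub, map_add, map_smul, ham, smul_eq_mul]
    linarith
  have e : ∀ z : ℂ, ∀ v : Tan m x, z ⊗ₜ[ℝ] v
      = z.re • ((1 : ℂ) ⊗ₜ[ℝ] v) + z.im • (Complex.I ⊗ₜ[ℝ] v) := by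
    intro z v
    rw [TensorProduct.smul_tmul', TensorProduct.smul_tmul', ← TensorProduct.add_tmul]
    congr 1
    simp [Complex.real_smul]
  rw [hamC, hamC, hre, him, smul_add, TensorProduct.smul_tmul', TensorProduct.smul_tmul',
    smul_eq_mul, smul_eq_mul, mul_one, e c, e (c * Complex.I)]
  simp only [TensorProduct.tmul_sub, TensorProduct.tmul_add, TensorProduct.tmul_smul,
    Complex.mul_re, Complex.mul_im, Complex.I_re, Complex.I_im, mul_zero, mul_one, zero_sub,
    add_zero, neg_smul]
  abel

end ComplexFunctions

/-! ### Degrees in the matrix $D$, and roots of constant local multiplicity. -/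

section DefMatrix

variable {m : ℕ} {M : Type*} [TopologicalSpace M] [ChartedSpace (EuclideanSpace ℝ (Fin m)) M]
  {k : ℕ} {N : Fin k → ℕ} {H : Fin k → ℕ → M → ℝ} {Z : Fin k → ∀ x : M, Tan m x}

lemma coeff_defMatrix (y : M) (a b : Fin k) (i : ℕ) :
    (defMatrix N H Z y a b).coeff i
      = ∑ j ∈ Finset.range (N a + 1), (if i = N a - j then 1 else 0) * lie (Z b) (H a j) y := by
  simp [defMatrix, Polynomial.finsetSum_coeff, Polynomial.coeff_C_mul, Polynomial.coeff_X_pow]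

lemma natDegree_defMatrix_le (y : M) (a b : Fin k) : (defMatrix N H Z y a b).natDegree ≤ N a := by
  rw [defMatrix, Matrix.of_apply]
  refine Polynomial.natDegree_sum_le_of_forall_le _ _ fun j _ => ?_
  exact (Polynomial.natDegree_C_mul_X_pow_le _ _).trans (Nat.sub_le _ _)

lemma natDegree_det_defMatrix_le (y : M) : (defMatrix N H Z y).det.natDegree ≤ ∑ a, N a :=
  natDegree_det_le N fun a b => natDegree_defMatrix_le y a b

lemma coeff_defMatrix_top (y : M) (a b : Fin k) :
    (defMatrix N H Z y a b).coeff (N a) = lie (Z b) (H a 0) y := by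
  rw [coeff_defMatrix, Finset.sum_eq_single 0]
  · simp
  · intro j hj hj0
    have := Finset.mem_range.1 hj
    rw [if_neg (by omega), zero_mul]
  · simp

/-- The derivative of a root of multiplicity `q + 1` of a family of polynomials on which the pencil
acts by multiplication with a constant. -/
lemma lieC_root {x : M} (ℓ₁ ℓ₀ : Module.Dual ℝ (Tan m x) →ₗ[ℝ] ℝ) (Q : family m x) (τ : ℝ)
    (hQ : pencilDeriv ℓ₁ ℓ₀ Q = -(Q.1 x * Polynomial.C τ)) {r : M → ℂ} (hr : CDiffAt m r x) (q : ℕ)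
    (hq : ∀ i ≤ q, ∀ᶠ y in nhds x,
      Polynomial.aeval (r y) (Polynomial.derivative^[i] (Q.1 y)) = 0)
    (hne : Polynomial.aeval (r x) (Polynomial.derivative^[q + 1] (Q.1 x)) ≠ 0) :
    lieC ℓ₁ r = r x * lieC ℓ₀ r := by
  have hval : ∀ i y, ((famDerivative)^[i] Q).1 y = Polynomial.derivative^[i] (Q.1 y) := by
    intro i
    induction i with
    | zero => intro y; rfl
    | succ i ih =>
      intro y
      rw [Function.iterate_succ_apply', Function.iterate_succ_apply', ← ih]
      rfl
  have hder : ∀ (ℓ : Module.Dual ℝ (Tan m x) →ₗ[ℝ] ℝ) i, famDeriv ℓ ((famDerivative)^[i] Q)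
      = Polynomial.derivative^[i] (famDeriv ℓ Q) := by
    intro ℓ i
    induction i with
    | zero => rfl
    | succ i ih =>
      rw [Function.iterate_succ_apply', Function.iterate_succ_apply', ← ih, famDeriv_famDerivative]
  have hchain : ∀ (ℓ : Module.Dual ℝ (Tan m x) →ₗ[ℝ] ℝ), ∀ i ≤ q,
      Polynomial.aeval (r x) (Polynomial.derivative^[i] (famDeriv ℓ Q))
        + Polynomial.aeval (r x) (Polynomial.derivative^[i + 1] (Q.1 x)) * lieC ℓ r = 0 := by
    intro ℓ i hi
    rw [Function.iterate_succ_apply', ← hval, ← hder, ← lieC_aeval ℓ _ hr,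
      lieC_congr ℓ (g := fun _ => 0), lieC_const]
    filter_upwards [hq i hi] with y hy
    rw [hval, hy]
  -- Since `τ` does not depend on $\lambda$, the right side becomes a multiple of the $q$-th
  -- derivative of $Q$ at the root, which vanishes.
  have hid := congrArg (fun p => Polynomial.aeval (r x) (Polynomial.derivative^[q] p)) hQ
  simp only [pencilDeriv_apply, Polynomial.iterate_derivative_sub, Polynomial.X_mul,
    Polynomial.iterate_derivative_mul_X, Polynomial.iterate_derivative_neg,
    mul_comm _ (Polynomial.C τ), Polynomial.iterate_derivative_C_mul, map_sub, map_add, map_mul,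
    map_neg, Polynomial.aeval_X, (hq q le_rfl).self_of_nhds, mul_zero, neg_zero, map_nsmul] at hid
  -- Differentiating the factor $\lambda$ leaves this extra term; it vanishes by the chain rule one
  -- order lower. For `q = 0` the factor `q` removes it.
  have h0 : q • Polynomial.aeval (r x) (Polynomial.derivative^[q - 1] (famDeriv ℓ₀ Q)) = 0 := by
    rcases q with _ | q
    · simp
    · have := hchain ℓ₀ q (Nat.le_succ q)
      rw [(hq (q + 1) le_rfl).self_of_nhds, zero_mul, add_zero] at this
      rw [Nat.add_sub_cancel, this, smul_zero]
  have h1 := hchain ℓ₁ q le_rfl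
  have h2 := hchain ℓ₀ q le_rfl
  rw [h0, add_zero] at hid
  refine mul_left_cancel₀ hne ?_
  linear_combination h1 - r x * h2 - hid

end DefMatrix

/-! ### The three claims: $\Delta$, its roots, and ratios of adjugate entries. -/

section Affine

variable {n k : ℕ} {M : Type*} [TopologicalSpace M]
  [ChartedSpace (EuclideanSpace ℝ (Fin (2 * n + k))) M] [IsManifold (𝓡 (2 * n + k)) ∞ M]
  {P₁ P₀ : TensorField (2 * n + k) M} {𝒵 : ∀ x : M, Submodule ℝ (Tan (2 * n + k) x)}
  {N : Fin k → ℕ} {H : Fin k → ℕ → M → ℝ} {Z : Fin k → ∀ x : M, Tan (2 * n + k) x}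

lemma IsAffine.diffAt_lie (hM : IsAffine P₁ P₀ 𝒵 N H Z) (a b : Fin k) {j : ℕ} (hj : j ≤ N a)
    (x : M) : DiffAt (2 * n + k) (lie (Z b) (H a j)) x :=
  (hM.isSmoothField_generator b Set.univ Set.univ (H a j) subset_rfl isOpen_univ
    (hM.smooth a j hj)).diffAt isOpen_univ (Set.mem_univ x)

lemma IsAffine.eval_defMatrix (hM : IsAffine P₁ P₀ 𝒵 N H Z) (y : M) (a b : Fin k) (t : ℝ) :
    (defMatrix N H Z y a b).eval t = lie (Z b) (polyFun (N a) (H a) t) y := by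
  rw [lie, hM.diff_polyFun, LinearMap.sum_apply, defMatrix, Matrix.of_apply,
    Polynomial.eval_finsetSum]
  refine Finset.sum_congr rfl fun j _ => ?_
  rw [Polynomial.eval_mul, Polynomial.eval_C, Polynomial.eval_pow, Polynomial.eval_X, mul_comm]
  rfl

/-- By normalization the matrix of row-leading coefficients of $D$ is the identity. -/
lemma IsAffine.coeff_det (hM : IsAffine P₁ P₀ 𝒵 N H Z) (y : M) :
    (defMatrix N H Z y).det.coeff (∑ a, N a) = 1 := by
  rw [coeff_det_sum N fun a b => natDegree_defMatrix_le y a b, ← Matrix.det_one (n := Fin k)]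
  congr 1
  ext a b
  rw [Matrix.of_apply, coeff_defMatrix_top, hM.normalized, Matrix.one_apply]

lemma IsAffine.monic_det (hM : IsAffine P₁ P₀ 𝒵 N H Z) (y : M) :
    (defMatrix N H Z y).det.Monic :=
  Polynomial.monic_of_natDegree_le_of_coeff_eq_one _ (natDegree_det_defMatrix_le y) (hM.coeff_det y)

lemma IsAffine.natDegree_det (hM : IsAffine P₁ P₀ 𝒵 N H Z) (y : M) :
    (defMatrix N H Z y).det.natDegree = ∑ a, N a :=
  le_antisymm (natDegree_det_defMatrix_le y)
    (Polynomial.le_natDegree_of_ne_zero (by rw [hM.coeff_det]; exact one_ne_zero))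

/-- The matrix `D` as a matrix of families of polynomials. -/
def IsAffine.famMatrix (hM : IsAffine P₁ P₀ 𝒵 N H Z) (x : M) :
    Matrix (Fin k) (Fin k) (family (2 * n + k) x) :=
  Matrix.of fun a b => ⟨fun y => defMatrix N H Z y a b,
    ⟨N a, fun y => natDegree_defMatrix_le y a b⟩, fun i => by
      simp only [coeff_defMatrix]
      exact DiffAt.sum _ fun j hj => (diffAt_const _ x).mul
        (hM.diffAt_lie a b (Nat.lt_succ_iff.1 (Finset.mem_range.1 hj)) x)⟩

lemma IsAffine.map_famMatrix (hM : IsAffine P₁ P₀ 𝒵 N H Z) (x y : M) :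
    (hM.famMatrix x).map (famEval x y) = defMatrix N H Z y := rfl

lemma IsAffine.det_famMatrix (hM : IsAffine P₁ P₀ 𝒵 N H Z) (x y : M) :
    (hM.famMatrix x).det.1 y = (defMatrix N H Z y).det :=
  (famEval x y).map_det (hM.famMatrix x)

lemma IsAffine.adjugate_famMatrix (hM : IsAffine P₁ P₀ 𝒵 N H Z) (x y : M) (a b : Fin k) :
    ((hM.famMatrix x).adjugate a b).1 y = (defMatrix N H Z y).adjugate a b :=
  congrFun (congrFun ((famEval x y).map_adjugate (hM.famMatrix x)) a) b

/-- The action of the deformed pencil on the matrix `D`, tested on the covector `α`. -/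
lemma IsAffine.exists_pencilDeriv_famMatrix (hM : IsAffine P₁ P₀ 𝒵 N H Z) (x : M)
    (α : Module.Dual ℝ (Tan (2 * n + k) x)) :
    ∃ θ : Matrix (Fin k) (Fin k) ℝ,
      (hM.famMatrix x).map (pencilDeriv (α ∘ₗ deformed P₁ (fun c => H c 0) Z x) (α ∘ₗ P₀ x))
        = -((hM.famMatrix x).map (famEval x x) * θ.map Polynomial.C) := by
  obtain ⟨W, hW⟩ := hM.exists_ham_deformed_lie x
  refine ⟨Matrix.of fun c b => α (W c b), ?_⟩
  ext1 a b
  refine Polynomial.funext fun t => ?_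
  have h := congrArg α (hW a b t)
  have he : (fun y => ((hM.famMatrix x a b).1 y).eval t)
      = lie (Z b) (polyFun (N a) (H a) t) := funext fun y => hM.eval_defMatrix y a b t
  rw [Matrix.map_apply, pencilDeriv_apply, Polynomial.eval_sub, Polynomial.eval_mul,
    Polynomial.eval_X, eval_famDeriv, eval_famDeriv, he, Matrix.neg_apply, Polynomial.eval_neg,
    Matrix.mul_apply, Polynomial.eval_finsetSum]
  rw [map_sub, map_smul, map_neg, map_sum, smul_eq_mul] at h
  refine Eq.trans h (congrArg Neg.neg (Finset.sum_congr rfl fun c _ => ?_))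
  rw [Polynomial.eval_mul, hM.map_famMatrix, hM.eval_defMatrix, Matrix.map_apply,
    Polynomial.eval_C, map_smul, smul_eq_mul, Matrix.of_apply]

/-- The action of the deformed pencil on `Δ` and on the adjugate of `D`, tested on the covector
`α`. -/
lemma IsAffine.exists_pencilDeriv_det (hM : IsAffine P₁ P₀ 𝒵 N H Z) (x : M)
    (α : Module.Dual ℝ (Tan (2 * n + k) x)) :
    ∃ (θ : Matrix (Fin k) (Fin k) ℝ),
      pencilDeriv (α ∘ₗ deformed P₁ (fun c => H c 0) Z x) (α ∘ₗ P₀ x) (hM.famMatrix x).det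
        = -((hM.famMatrix x).det.1 x * Polynomial.C θ.trace) ∧
      (∀ a b, pencilDeriv (α ∘ₗ deformed P₁ (fun c => H c 0) Z x) (α ∘ₗ P₀ x)
          ((hM.famMatrix x).adjugate a b)
        = ∑ e, Polynomial.C (θ a e) * (defMatrix N H Z x).adjugate e b
          - Polynomial.C θ.trace * (defMatrix N H Z x).adjugate a b) ∧
      α (P₀ x (diff (2 * n + k) (fun y => -(defMatrix N H Z y).det.nextCoeff) x)) = -θ.trace := by
  obtain ⟨θ, hθ⟩ := hM.exists_pencilDeriv_famMatrix x α
  set ℓ₁ := α ∘ₗ deformed P₁ (fun c => H c 0) Z x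
  set ℓ₀ := α ∘ₗ P₀ x
  have hder := isDeriv_pencilDeriv ℓ₁ ℓ₀
  have htr : (θ.map Polynomial.C).trace = Polynomial.C θ.trace := by
    simp [Matrix.trace, map_sum]
  have h1 : pencilDeriv ℓ₁ ℓ₀ (hM.famMatrix x).det
      = -((hM.famMatrix x).det.1 x * Polynomial.C θ.trace) := by
    rw [hder.det_of_map_eq hθ, htr, hM.map_famMatrix, hM.det_famMatrix]
  refine ⟨θ, h1, fun a b => ?_, ?_⟩
  · have h := congrFun (congrFun (hder.adjugate_of_map_eq hθ (by
      rw [hM.map_famMatrix]; exact (hM.monic_det x).ne_zero)) a) b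
    rw [htr, hM.map_famMatrix, Matrix.sub_mul, Matrix.smul_mul, Matrix.one_mul] at h
    exact h
  -- The coefficient of $\lambda^\nu$ in $\Delta$ is constantly one, so only $-\lambda$ times the
  -- derivative of the next coefficient contributes on the left.
  · have hc := congrArg (fun p => Polynomial.coeff p (∑ a, N a)) h1
    simp only [pencilDeriv_apply, Polynomial.coeff_sub, Polynomial.coeff_neg,
      Polynomial.coeff_mul_C, coeff_famDeriv, hM.det_famMatrix, hM.coeff_det, diff_const, map_zero,
      one_mul, zero_sub] at hc
    rw [← hc]
    -- For degree zero `nextCoeff` is zero by definition, matching the convention $\Delta_1=0$.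
    rcases hν : ∑ a, N a with _ | ν
    · have : (fun y => -(defMatrix N H Z y).det.nextCoeff) = fun _ => 0 := by
        funext y
        rw [Polynomial.nextCoeff, if_pos (by rw [hM.natDegree_det, hν]), neg_zero]
      rw [this, diff_const, map_zero, map_zero, Polynomial.coeff_X_mul_zero, neg_zero]
    · have : (fun y => -(defMatrix N H Z y).det.nextCoeff)
          = fun y => -(defMatrix N H Z y).det.coeff ν := by
        funext y
        rw [Polynomial.nextCoeff_of_natDegree_pos (by rw [hM.natDegree_det, hν]; omega),
          hM.natDegree_det, hν, Nat.add_sub_cancel]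
      rw [this, diff_neg, map_neg, map_neg, Polynomial.coeff_X_mul, coeff_famDeriv]
      simp only [hM.det_famMatrix]
      rfl

theorem IsAffine.ham_deformed_det (hM : IsAffine P₁ P₀ 𝒵 N H Z) (t : ℝ) (x : M) :
    ham (deformed P₁ (fun c => H c 0) Z) (fun y => (defMatrix N H Z y).det.eval t) x
      = t • ham P₀ (fun y => (defMatrix N H Z y).det.eval t) x
        + (defMatrix N H Z x).det.eval t
          • ham P₀ (fun y => -(defMatrix N H Z y).det.nextCoeff) x := by
  refine (Module.forall_dual_apply_eq_zero_iff ℝ _).1 (fun α => ?_) |> sub_eq_zero.1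
  obtain ⟨θ, h1, -, h2⟩ := hM.exists_pencilDeriv_det x α
  have h := congrArg (Polynomial.eval t) h1
  simp only [pencilDeriv_apply, Polynomial.eval_sub, Polynomial.eval_mul, Polynomial.eval_X,
    eval_famDeriv, hM.det_famMatrix, Polynomial.eval_neg, Polynomial.eval_C,
    LinearMap.comp_apply] at h
  simp only [map_sub, map_add, map_smul, smul_eq_mul, ham, h2]
  linear_combination h

/-- Skew-symmetry moves the tensors onto `g`, leaving derivatives of a $C^1$ function along smooth
fields. Continuity makes the failure set of the eigenvalue equation open. -/
lemma IsAffine.continuousOn_lieC (hM : IsAffine P₁ P₀ 𝒵 N H Z) {U : Set M} (hU : IsOpen U)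
    {g : M → ℝ} (hg : SmoothOn (2 * n + k) g U) {r : M → ℂ}
    (hr : ContMDiffOn (𝓡 (2 * n + k)) 𝓘(ℝ, ℂ) 1 r U) :
    ContinuousOn (fun y => lieC (diff (2 * n + k) g y ∘ₗ deformed P₁ (fun c => H c 0) Z y) r
      - r y * lieC (diff (2 * n + k) g y ∘ₗ P₀ y) r) U := by
  have hT := hM.transversal.bihamiltonian
  have key : ∀ u : M → ℝ, ContMDiffOn (𝓡 (2 * n + k)) 𝓘(ℝ, ℝ) 1 u U →
      ContinuousOn (fun y => diff (2 * n + k) g y (P₀ y (diff (2 * n + k) u y))) U ∧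
      ContinuousOn (fun y => diff (2 * n + k) g y
        (deformed P₁ (fun c => H c 0) Z y (diff (2 * n + k) u y))) U := by
    intro u hu
    have hc : ∀ V : ∀ x : M, Tan (2 * n + k) x, IsSmoothField V U →
        ∀ f : M → ℝ, ContMDiffOn (𝓡 (2 * n + k)) 𝓘(ℝ, ℝ) 1 f U →
        ContinuousOn (lie V f) U :=
      fun V hV f hf y hy => (hV.continuousAt_lie hU hf hy).continuousWithinAt
    have hg1 : ContMDiffOn (𝓡 (2 * n + k)) 𝓘(ℝ, ℝ) 1 g U := hg.of_le (by simp)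
    constructor
    · refine (hc _ (hT.poisson_zero.isSmoothField_ham hg) u hu).neg.congr fun y _ => ?_
      exact hT.poisson_zero.skew y _ _
    · have h1 := (hc _ (hT.poisson_one.isSmoothField_ham hg) u hu).neg
      have h2 : ContinuousOn (fun y => ∑ c, (lie (Z c) u y * lie (ham P₁ (H c 0)) g y
          - lie (ham P₁ (H c 0)) u y * lie (Z c) g y)) U :=
        continuousOn_finsetSum _ fun c _ =>
          ((hc _ (hM.isSmoothField_generator c U) u hu).mul
            (hc _ (hM.isSmoothField_ham_casimir c U) g hg1)).sub
          ((hc _ (hM.isSmoothField_ham_casimir c U) u hu).mul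
            (hc _ (hM.isSmoothField_generator c U) g hg1))
      refine (h1.sub h2).congr fun y _ => ?_
      rw [deformed_apply, map_sub, map_sum]
      refine congrArg₂ _ (hT.poisson_one.skew y _ _) (Finset.sum_congr rfl fun c _ => ?_)
      rw [map_sub, map_smul, map_smul]
      rfl
  have hre := key _ (Complex.reCLM.contDiff.contMDiff.comp_contMDiffOn hr)
  have him := key _ (Complex.imCLM.contDiff.contMDiff.comp_contMDiffOn hr)
  refine ContinuousOn.sub ?_ (hr.continuousOn.mul ?_)
  · exact (Complex.continuous_ofReal.comp_continuousOn hre.2).add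
      ((Complex.continuous_ofReal.comp_continuousOn him.2).mul continuousOn_const)
  · exact (Complex.continuous_ofReal.comp_continuousOn hre.1).add
      ((Complex.continuous_ofReal.comp_continuousOn him.1).mul continuousOn_const)

/-- The roots of `Δ` are eigenvalues of the deformed pencil. -/
lemma IsAffine.lieC_root (hM : IsAffine P₁ P₀ 𝒵 N H Z) {U : Set M} (hU : IsOpen U) {r : M → ℂ}
    (hr : ContMDiffOn (𝓡 (2 * n + k)) 𝓘(ℝ, ℂ) 1 r U)
    (hroot : ∀ x ∈ U, Polynomial.aeval (r x) (defMatrix N H Z x).det = 0) {x : M} (hx : x ∈ U)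
    (α : Module.Dual ℝ (Tan (2 * n + k) x)) :
    lieC (α ∘ₗ deformed P₁ (fun c => H c 0) Z x) r = r x * lieC (α ∘ₗ P₀ x) r := by
  -- Extending the covector to an exact form allows the defect of the equation to be followed at
  -- nearby points.
  obtain ⟨g, hg, rfl⟩ := exists_diff_eq x α
  set S := (chartAt (EuclideanSpace ℝ (Fin (2 * n + k))) x).source
  have hS : IsOpen S := (chartAt (EuclideanSpace ℝ (Fin (2 * n + k))) x).open_source
  have hUS : IsOpen (U ∩ S) := hU.inter hS
  have hcont := hM.continuousOn_lieC hUS (hg.mono Set.inter_subset_right)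
    (hr.mono Set.inter_subset_left)
  by_contra hne
  set Φ := fun y => lieC (diff (2 * n + k) g y ∘ₗ deformed P₁ (fun c => H c 0) Z y) r
      - r y * lieC (diff (2 * n + k) g y ∘ₗ P₀ y) r with hΦ
  set V := (U ∩ S) ∩ Φ ⁻¹' {0}ᶜ with hV
  have hVo : IsOpen V := hcont.isOpen_inter_preimage hUS isOpen_compl_singleton
  have hxV : x ∈ V := ⟨⟨hx, mem_chart_source _ x⟩, fun h => hne (sub_eq_zero.1 h)⟩
  -- Some order works: the $\nu$-th derivative of the monic $\Delta$ is the constant $\nu!$.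
  have hex : ∃ p, ∃ y ∈ V, Polynomial.aeval (r y)
      (Polynomial.derivative^[p] (defMatrix N H Z y).det) ≠ 0 := by
    refine ⟨∑ a, N a, x, hxV, ?_⟩
    have hd := Polynomial.natDegree_iterate_derivative (defMatrix N H Z x).det (∑ a, N a)
    rw [hM.natDegree_det, Nat.sub_self, Nat.le_zero] at hd
    rw [Polynomial.eq_C_of_natDegree_eq_zero hd, Polynomial.aeval_C,
      Polynomial.coeff_iterate_derivative, zero_add, hM.coeff_det]
    simp [Nat.descFactorial_self, Nat.factorial_ne_zero]
  classical
  obtain ⟨y, hyV, hy⟩ := Nat.find_spec hex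
  -- Minimality is over all of `V`, so the lower derivatives vanish on a neighbourhood of `y`, not
  -- only at `y`.
  have hmin : ∀ i < Nat.find hex, ∀ z ∈ V, Polynomial.aeval (r z)
      (Polynomial.derivative^[i] (defMatrix N H Z z).det) = 0 := by
    intro i hi z hz
    by_contra h
    exact Nat.find_min hex hi ⟨z, hz, h⟩
  obtain ⟨q, hq⟩ : ∃ q, Nat.find hex = q + 1 := by
    refine Nat.exists_eq_succ_of_ne_zero fun h0 => hy ?_
    rw [h0]
    exact hroot y hyV.1.1
  rw [hq] at hy hmin
  obtain ⟨θ, h1, -, -⟩ := hM.exists_pencilDeriv_det y (diff (2 * n + k) g y)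
  have hfin := BiHam.lieC_root _ _ (hM.famMatrix y).det θ.trace h1
    ((hr.contMDiffAt (hU.mem_nhds hyV.1.1)).mdifferentiableAt (by simp)) q
    (fun i hi => by
      filter_upwards [hVo.mem_nhds hyV] with z hz
      rw [hM.det_famMatrix]
      exact hmin i (by omega) z hz)
    (by rwa [hM.det_famMatrix])
  exact hyV.2 (sub_eq_zero.2 hfin)

lemma IsAffine.lieC_ratio (hM : IsAffine P₁ P₀ 𝒵 N H Z) {x : M} {r : M → ℂ}
    (hr : CDiffAt (2 * n + k) r x) (hroot : Polynomial.aeval (r x) (defMatrix N H Z x).det = 0)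
    (α : Module.Dual ℝ (Tan (2 * n + k) x))
    (hrα : lieC (α ∘ₗ deformed P₁ (fun c => H c 0) Z x) r = r x * lieC (α ∘ₗ P₀ x) r)
    (a b c : Fin k) (hne : Polynomial.aeval (r x) ((defMatrix N H Z x).adjugate a c) ≠ 0) :
    lieC (α ∘ₗ deformed P₁ (fun c => H c 0) Z x)
        (fun y => Polynomial.aeval (r y) ((defMatrix N H Z y).adjugate a b)
          / Polynomial.aeval (r y) ((defMatrix N H Z y).adjugate a c))
      = r x * lieC (α ∘ₗ P₀ x)
        (fun y => Polynomial.aeval (r y) ((defMatrix N H Z y).adjugate a b)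
          / Polynomial.aeval (r y) ((defMatrix N H Z y).adjugate a c)) := by
  obtain ⟨θ, -, hadj, -⟩ := hM.exists_pencilDeriv_det x α
  set ℓ₁ := α ∘ₗ deformed P₁ (fun c => H c 0) Z x
  set ℓ₀ := α ∘ₗ P₀ x
  set A : Fin k → Fin k → M → ℂ :=
    fun a b y => Polynomial.aeval (r y) ((defMatrix N H Z y).adjugate a b) with hA
  have hAeq : ∀ a b, A a b
      = fun y => Polynomial.aeval (r y) (((hM.famMatrix x).adjugate a b).1 y) := by
    intro a b
    funext y
    rw [hM.adjugate_famMatrix]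
  have hAd : ∀ a b, CDiffAt (2 * n + k) (A a b) x := fun a b => by
    rw [hAeq]; exact cdiffAt_aeval _ hr
  -- The chain-rule terms from the motion of the root cancel by the eigenvalue equation, leaving the
  -- action on coefficients.
  have hΛ : ∀ b, lieC ℓ₁ (A a b) - r x * lieC ℓ₀ (A a b)
      = ∑ e, (θ a e : ℂ) * A e b x - (θ.trace : ℂ) * A a b x := by
    intro b
    have h := congrArg (Polynomial.aeval (r x)) (hadj a b)
    simp only [pencilDeriv_apply, map_sub, map_mul, map_sum, Polynomial.aeval_X,
      Polynomial.aeval_C, Complex.coe_algebraMap] at h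
    rw [hAeq, lieC_aeval ℓ₁ _ hr, lieC_aeval ℓ₀ _ hr, hrα]
    simp only [hM.adjugate_famMatrix]
    linear_combination h
  have hminor : ∀ e, A a c x * A e b x = A a b x * A e c x := by
    intro e
    have hmap : ∀ i j, ((defMatrix N H Z x).map (Polynomial.aeval (r x) : ℝ[X] →ₐ[ℝ] ℂ)).adjugate
        i j = A i j x := fun i j =>
      (congrFun (congrFun (RingHom.map_adjugate
        (Polynomial.aeval (r x) : ℝ[X] →ₐ[ℝ] ℂ).toRingHom (defMatrix N H Z x)) i) j).symm
    have hdet : ((defMatrix N H Z x).map (Polynomial.aeval (r x) : ℝ[X] →ₐ[ℝ] ℂ)).det = 0 :=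
      (RingHom.map_det (Polynomial.aeval (r x) : ℝ[X] →ₐ[ℝ] ℂ).toRingHom
        (defMatrix N H Z x)).symm.trans hroot
    have := adjugate_mul_eq_of_det_eq_zero hdet (a := a) (c := c) (by rw [hmap]; exact hne) b e
    simpa only [hmap] using this
  set ρ : M → ℂ := fun y => A a b y / A a c y with hρ
  have hρd : CDiffAt (2 * n + k) ρ x := by
    simp only [hρ, div_eq_mul_inv]
    exact (hAd a b).mul ((hAd a c).inv hne)
  have hev : A a b =ᶠ[nhds x] fun y => ρ y * A a c y := by
    filter_upwards [(hAd a c).continuousAt.eventually_ne hne] with y hy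
    rw [hρ, div_mul_cancel₀ _ hy]
  have hprod : ∀ ℓ : Module.Dual ℝ (Tan (2 * n + k) x) →ₗ[ℝ] ℝ,
      lieC ℓ (A a b) = ρ x * lieC ℓ (A a c) + A a c x * lieC ℓ ρ := fun ℓ => by
    rw [lieC_congr ℓ hev, lieC_mul ℓ hρd (hAd a c)]
  have hρx : ρ x * A a c x = A a b x := div_mul_cancel₀ _ hne
  -- The vanishing minors make the $\theta$-terms of numerator and denominator proportional; the
  -- trace terms are so already.
  have hsum : A a c x * ∑ e, (θ a e : ℂ) * A e b x = A a b x * ∑ e, (θ a e : ℂ) * A e c x := by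
    rw [Finset.mul_sum, Finset.mul_sum]
    refine Finset.sum_congr rfl fun e _ => ?_
    linear_combination (θ a e : ℂ) * hminor e
  have hb := hΛ b
  rw [hprod ℓ₁, hprod ℓ₀] at hb
  have hc := hΛ c
  refine mul_left_cancel₀ hne (mul_left_cancel₀ hne ?_)
  change A a c x * (A a c x * lieC ℓ₁ ρ) = A a c x * (A a c x * (r x * lieC ℓ₀ ρ))
  linear_combination A a c x * hb - A a b x * hc + hsum
    - (lieC ℓ₁ (A a c) - r x * lieC ℓ₀ (A a c)) * hρx

end Affine

end BiHam

end

theorem mainTheorem3 {n k : ℕ} {M : Type*} [TopologicalSpace M]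
    [ChartedSpace (EuclideanSpace ℝ (Fin (2 * n + k))) M]
    [IsManifold (𝓡 (2 * n + k)) ∞ M]
    (P₁ P₀ : BiHam.TensorField (2 * n + k) M)
    (𝒵 : ∀ x : M, Submodule ℝ (BiHam.Tan (2 * n + k) x))
    (N : Fin k → ℕ) (H : Fin k → ℕ → M → ℝ)
    (Z : Fin k → ∀ x : M, BiHam.Tan (2 * n + k) x)
    (hM : BiHam.IsAffine P₁ P₀ 𝒵 N H Z)
    (Pt : BiHam.TensorField (2 * n + k) M)
    (hPt : Pt = BiHam.deformed P₁ (fun a => H a 0) Z)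
    (D : M → Matrix (Fin k) (Fin k) ℝ[X]) (hD : D = BiHam.defMatrix N H Z)
    (Δ : M → ℝ[X]) (hΔ : Δ = fun x => (D x).det)
    (Δ₁ : M → ℝ) (hΔ₁ : Δ₁ = fun x => -(Δ x).nextCoeff) :
    (∀ x, (Δ x).Monic ∧ (Δ x).natDegree = ∑ a, N a) ∧
    (∀ (t : ℝ) (x : M),
      BiHam.ham Pt (fun y => (Δ y).eval t) x
        = t • BiHam.ham P₀ (fun y => (Δ y).eval t) x
          + (Δ x).eval t • BiHam.ham P₀ Δ₁ x) ∧
    ∀ (U : Set M) (r : M → ℂ), IsOpen U →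
      ContMDiffOn (𝓡 (2 * n + k)) 𝓘(ℝ, ℂ) 1 r U →
      (∀ x ∈ U, Polynomial.aeval (r x) (Δ x) = 0) →
      (∀ x ∈ U, BiHam.hamC Pt r x = r x • BiHam.hamC P₀ r x) ∧
      ∀ (a b c : Fin k) (ρ : M → ℂ),
        (ρ = fun x => Polynomial.aeval (r x) ((D x).adjugate a b)
          / Polynomial.aeval (r x) ((D x).adjugate a c)) →
        ∀ x ∈ U, Polynomial.aeval (r x) ((D x).adjugate a c) ≠ 0 →
          BiHam.hamC Pt ρ x = r x • BiHam.hamC P₀ ρ x := by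
  subst hPt hD hΔ hΔ₁
  refine ⟨fun x => ⟨hM.monic_det x, hM.natDegree_det x⟩, hM.ham_deformed_det,
    fun U r hU hr hroot => ⟨fun x hx => ?_, ?_⟩⟩
  · exact BiHam.hamC_eq_smul_of_forall _ (hM.lieC_root hU hr hroot hx)
  · rintro a b c ρ rfl x hx hne
    exact BiHam.hamC_eq_smul_of_forall _ fun α => hM.lieC_ratio
      ((hr.contMDiffAt (hU.mem_nhds hx)).mdifferentiableAt (by simp)) (hroot x hx) α
      (hM.lieC_root hU hr hroot hx α) a b c hne
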